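/- Let $k$ be an algebraically closed field of characteristic $p>0$. For a self-map $f$ of a set $X$ such that $\mathrm{Per}_n(f)=\{x\in X: f^n(x)=x\}$ is finite for all $n\ge 1$ ($f^n$ being the $n$-fold composite), put $$\zeta(f,X;t)=\exp\Big(\sum_{n\ge 1}\#\mathrm{Per}_n(f)\,\frac{t^n}{n}\Big)\in\mathbb{Q}[[t]].$$ An *affine morphism* of the additive group is a polynomial $\psi=\sigma+c$, where $c\in k$ and $\sigma\in k[x]$ is additive (that is, $\sigma(x+y)=\sigma(x)+\sigma(y)$ for all $x,y\in k$) of degree at least $2$. A polynomial $f\in k[x]$ is *subadditive* if $f(x^d)=\psi(x)^d$ for some integer $d>1$ prime to $p$ and some such affine morphism $\psi$. **Theorem 1.3.** Let $f\in k[x]$ be either an additive polynomial of degree at least $2$, possibly composed with a translation (that is, $f$ is itself an affine morphism of the additive group), or a subadditive polynomial. Suppose that $f$ is separable as a self-map of $\mathbb{P}^1(k)$, i.e. its derivative $f'$ is not the zero polynomial. Let $f$ act on $\mathbb{P}^1(k)=k\cup\{\infty\}$ with $f(\infty)=\infty$. Then $\mathrm{Per}_n(f)$ is finite for every $n\ge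 1$, and: 1. If $f'(0)$ is algebraic over $\mathbb{F}_p$, then $\zeta(f,\mathbb{P}^1(k);t)$ is transcendental over $\mathbb{Q}(t)$. 2. If $f'(0)$ is transcendental over $\mathbb{F}_p$, then $\#\mathrm{Per}_n(f)=1+(\deg f)^n$ for every $n\ge 1$, and $\zeta(f,\mathbb{P}^1(k);t)$ is a rational function, i.e. lies in $\mathbb{Q}(t)$. -/

import Mathlib

open Polynomial

/-- The exponent `∑_{n ≥ 1} #Per_n(f) t^n / n` of the Artin–Mazur zeta function, where
`Per_n(f) = {x | f^n(x) = x}` (the `n`-fold composite of `f`). -/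
noncomputable def artinMazurExponent {X : Type*} (f : X → X) : PowerSeries ℚ :=
  PowerSeries.mk fun n => if n = 0 then 0 else ((Function.ptsOfPeriod f n).ncard : ℚ) / (n : ℚ)

/-- The exponent has no constant term, so it may be substituted into a power series. -/
theorem artinMazurExponent_hasSubst {X : Type*} (f : X → X) :
    PowerSeries.HasSubst (artinMazurExponent f) :=
  PowerSeries.HasSubst.of_constantCoeff_zero' (by
    rw [← PowerSeries.coeff_zero_eq_constantCoeff_apply, artinMazurExponent,
      PowerSeries.coeff_mk, if_pos rfl])

/-- The Artin–Mazur zeta function `ζ(f, X; t) = exp (∑_{n ≥ 1} #Per_n(f) t^n / n)`, a formal power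
series over `ℚ`. (It is meaningful when every `Per_n(f)`, `n ≥ 1`, is finite.) -/
noncomputable def artinMazurZeta {X : Type*} (f : X → X) : PowerSeries ℚ :=
  (PowerSeries.exp ℚ).subst (artinMazurExponent f)

/-- The self-map of `ℙ¹(k) = k ∪ {∞}` given by a nonconstant polynomial `f`: it fixes `∞`. -/
noncomputable def polyMapP1 {k : Type*} [Field k] (f : k[X]) : OnePoint k → OnePoint k :=
  OnePoint.map fun x => f.eval x

/-- `σ` is additive: it defines an endomorphism of the additive group. -/
def IsAdditivePoly {k : Type*} [Field k] (σ : k[X]) : Prop :=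
  ∀ x y : k, σ.eval (x + y) = σ.eval x + σ.eval y

/-- Affine morphisms of the additive group: an endomorphism of degree at least `2` followed by a
translation. With `c = 0` these are the additive polynomials of degree at least `2`. -/
def IsAffineAdditivePoly {k : Type*} [Field k] (ψ : k[X]) : Prop :=
  ∃ (σ : k[X]) (c : k), IsAdditivePoly σ ∧ 2 ≤ σ.natDegree ∧ ψ = σ + C c

/-- `f` is subadditive (in characteristic `p`): for some `d > 1` prime to `p`, it is the map induced
by an affine morphism `ψ` of the additive group on the quotient by the group `μ_d` of `d`-th roots
of unity, the quotient map being `x ↦ x ^ d`; that is, `f (x ^ d) = ψ(x) ^ d`. -/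
def IsSubadditivePoly (p : ℕ) {k : Type*} [Field k] (f : k[X]) : Prop :=
  ∃ (d : ℕ) (ψ : k[X]), 1 < d ∧ p.Coprime d ∧ IsAffineAdditivePoly ψ ∧ f.comp (X ^ d) = ψ ^ d

section

open scoped RatFunc

/-- The formal power series `z` over the field `F` is a rational function, i.e. it lies in the
subfield `F(t)` of the field `F((t))` of Laurent series. -/
def IsRationalSeries {F : Type*} [Field F] (z : PowerSeries F) : Prop :=
  ∃ r : RatFunc F, algebraMap (RatFunc F) (LaurentSeries F) r = (z : LaurentSeries F)

/-- The formal power series `z` over the field `F` is transcendental over `F(t)`, as an element of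
the field `F((t))` of Laurent series. -/
def IsTranscendentalSeries {F : Type*} [Field F] (z : PowerSeries F) : Prop :=
  Transcendental (RatFunc F) (z : LaurentSeries F)

end

/-! Write `D` for the degree of `f`. Up to a bijection of `k`, `f` is the map induced by an additive
`σ` of degree `D` on the quotient of `k` by the `d`-th roots of unity, with `d = 1` in the affine
case. With `a = σ'(0)` one has `f'(0) = a ^ d`, and `a ≠ 0` by separability. Finite points of period
`n` come from solutions of `σ^n(x) = w x` with `w ^ d = 1`, so `d · #Per_n` is the sum over `w` of
the orders of the kernels of `σ^n - w` (`mul_ncard_ptsOfPeriod`).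

An additive polynomial has constant derivative, so the kernel of `σ^n - w` has the full order `D ^
n` unless `w = a ^ n`. Hence `#Per_n = 1 + D ^ n` on the projective line whenever `f'(0) ^ n ≠ 1`.
If `f'(0)` is transcendental this covers every `n`, and the zeta function is `1 / ((1 - t)(1 - D
t))`.

If `f'(0)` is algebraic it has some finite order `m`, and for `n = m j` exactly one kernel is too
small. Writing `j = p ^ e q` with `q` prime to `p`, Frobenius gives `σ^(mj) - a^(mj) = (σ^(mq) -
a^(mq))^(p^e)`, and the base is `σ^m - a^m` times a separable factor. The kernel thus has order
`D^(mj) S^(-p^e)` for a constant `S > 1` (`card_ker_toEnd_pow_sub`).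

Were zeta algebraic, so would be its logarithmic derivative, and hence `∑ #Per_n t^n`. The
dependence on `e` makes this series blow up radially at `ζ / D` for every primitive root of unity
`ζ` of order `m p^(E+1)`, for all `E` (`exists_evalsTo_tendsto_norm_atTop`). An algebraic function
can blow up only at the finitely many roots of the leading coefficient of its equation, a
contradiction. -/

/-! ### Orders of kernels of additive polynomials. -/

section Kernels

/-- The kernel of an endomorphism of an additive commutative group. -/
def endKer {G : Type*} [AddCommGroup G] (α : AddMonoid.End G) : AddSubgroup G :=
  AddMonoidHom.ker (α : G →+ G)

theorem mem_endKer {G : Type*} [AddCommGroup G] {α : AddMonoid.End G} {x : G} :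
    x ∈ endKer α ↔ α x = 0 := Iff.rfl

variable {k : Type*} [Field k]

/-- The endomorphism of the additive group of `k` defined by an additive polynomial. -/
def IsAdditivePoly.toEnd {σ : k[X]} (h : IsAdditivePoly σ) : AddMonoid.End k :=
  AddMonoidHom.mk' (fun x => σ.eval x) h

theorem IsAdditivePoly.toEnd_pow_apply {σ : k[X]} (h : IsAdditivePoly σ) (n : ℕ) (x : k) :
    (h.toEnd ^ n) x = (σ.comp^[n] X).eval x := by
  rw [iterate_comp_eval, eval_X]
  induction n with
  | zero => rfl
  | succ n ih =>
    rw [pow_succ', Function.iterate_succ_apply', ← ih]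
    rfl

theorem IsAdditivePoly.eval_zero {σ : k[X]} (h : IsAdditivePoly σ) : σ.eval 0 = 0 :=
  map_zero h.toEnd

theorem isAdditivePoly_of_end (α : AddMonoid.End k) {τ : k[X]} (h : ∀ x, α x = τ.eval x) :
    IsAdditivePoly τ := fun x y => by simp [← h]

/-- Differentiate `τ(x + a) = τ(x) + τ(a)` at `x = 0`. Infinitude of `k` turns the identity of
values into one of polynomials. -/
theorem IsAdditivePoly.eval_derivative [Infinite k] {τ : k[X]} (h : IsAdditivePoly τ) (a : k) :
    (derivative τ).eval a = (derivative τ).eval 0 := by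
  have key : τ.comp (X + C a) = τ + C (τ.eval a) := by
    refine Polynomial.funext fun x => ?_
    simp [h x a]
  have := congrArg (fun q => (derivative q).eval 0) key
  simpa [derivative_comp] using this

theorem IsAdditivePoly.derivative_eq_C [Infinite k] {τ : k[X]} (h : IsAdditivePoly τ) :
    derivative τ = C ((derivative τ).eval 0) :=
  Polynomial.funext fun x => by rw [h.eval_derivative x, eval_C]

theorem eval_derivative_iterate_comp {σ : k[X]} (h0 : σ.eval 0 = 0) (n : ℕ) :
    (σ.comp^[n] X).eval 0 = 0 ∧
      (derivative (σ.comp^[n] X)).eval 0 = ((derivative σ).eval 0) ^ n := by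
  induction n with
  | zero => simp
  | succ n ih =>
    rw [Function.iterate_succ_apply', derivative_comp, eval_mul, eval_comp, eval_comp, ih.1, ih.2]
    exact ⟨h0, by ring⟩

theorem ker_eq_roots (α : AddMonoid.End k) {τ : k[X]} (h : ∀ x, α x = τ.eval x) (hτ : τ ≠ 0)
    [DecidableEq k] :
    (endKer (α) : Set k) = (τ.roots.toFinset : Set k) := by
  ext x
  simp only [SetLike.mem_coe, mem_endKer, Multiset.mem_toFinset,
    mem_roots hτ, IsRoot]
  rw [← h x]

theorem finite_ker (α : AddMonoid.End k) {τ : k[X]} (h : ∀ x, α x = τ.eval x) (hτ : τ ≠ 0) :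
    (endKer (α) : Set k).Finite := by
  classical
  rw [ker_eq_roots α h hτ]
  exact Finset.finite_toSet _

theorem card_ker_eq_roots (α : AddMonoid.End k) {τ : k[X]} (h : ∀ x, α x = τ.eval x) (hτ : τ ≠ 0)
    [DecidableEq k] :
    Nat.card (endKer α) = τ.roots.toFinset.card := by
  rw [← SetLike.coe_sort_coe, Nat.card_coe_set_eq, ker_eq_roots α h hτ, Set.ncard_coe_finset]

/-- The derivative is a nonzero constant, hence coprime to `τ`, so all roots are simple. -/
theorem card_ker_of_eval_derivative_ne_zero [IsAlgClosed k] (α : AddMonoid.End k) {τ : k[X]}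
    (h : ∀ x, α x = τ.eval x) (hd : (derivative τ).eval 0 ≠ 0) :
    Nat.card (endKer α) = τ.natDegree := by
  classical
  have : Infinite k := IsAlgClosed.instInfinite
  have hτ : τ ≠ 0 := by rintro rfl; simp at hd
  rw [card_ker_eq_roots α h hτ, Multiset.toFinset_card_of_nodup,
    IsAlgClosed.card_roots_eq_natDegree]
  refine nodup_roots ?_
  rw [separable_def, (isAdditivePoly_of_end α h).derivative_eq_C]
  exact isCoprime_one_right.of_isCoprime_of_dvd_right
    (isUnit_iff_dvd_one.1 (isUnit_C.2 (isUnit_iff_ne_zero.2 hd)))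

/-- Here `0` is a multiple root, so distinct roots are fewer than the degree. -/
theorem card_ker_lt_of_eval_derivative_eq_zero [IsAlgClosed k] (α : AddMonoid.End k) {τ : k[X]}
    (h : ∀ x, α x = τ.eval x) (hτ : τ ≠ 0) (hd : (derivative τ).eval 0 = 0) :
    Nat.card (endKer α) < τ.natDegree := by
  classical
  rw [card_ker_eq_roots α h hτ, ← IsAlgClosed.card_roots_eq_natDegree (p := τ)]
  refine lt_of_le_of_ne (Multiset.toFinset_card_le _) fun heq => ?_
  have hnd := Multiset.toFinset_card_eq_card_iff_nodup.1 heq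
  have h1 := Multiset.nodup_iff_count_le_one.1 hnd 0
  rw [count_roots] at h1
  have h2 : 1 < τ.rootMultiplicity 0 :=
    (one_lt_rootMultiplicity_iff_isRoot hτ).2 ⟨(isAdditivePoly_of_end α h).eval_zero, hd⟩
  omega

theorem surjective_of_natDegree_ne_zero [IsAlgClosed k] (α : AddMonoid.End k) {τ : k[X]}
    (h : ∀ x, α x = τ.eval x) (hd : τ.natDegree ≠ 0) : Function.Surjective α := by
  intro y
  obtain ⟨x, hx⟩ := IsAlgClosed.exists_root (τ - C y) (by
    rw [degree_sub_C (natDegree_pos_iff_degree_pos.1 (Nat.pos_of_ne_zero hd))]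
    exact (natDegree_pos_iff_degree_pos.1 (Nat.pos_of_ne_zero hd)).ne')
  exact ⟨x, by rw [h x]; simpa [IsRoot, sub_eq_zero] using hx⟩

theorem card_ker_mul {G : Type*} [AddCommGroup G] (α β : AddMonoid.End G)
    (hβ : Function.Surjective β) :
    Nat.card (endKer (α * β)) =
      Nat.card (endKer α) * Nat.card (endKer β) := by
  have hle : endKer β ≤ endKer (α * β) := fun x hx => by
    have hx' : β x = 0 := hx
    show α (β x) = 0
    rw [hx', map_zero]
  have h1 : endKer (α * β) = (endKer α).comap (show G →+ G from β) := rfl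
  have h2 : endKer β = (⊥ : AddSubgroup G).comap (show G →+ G from β) := rfl
  have h3 : (endKer β).relIndex (endKer (α * β)) = Nat.card (endKer α) := by
    rw [h1, h2, AddSubgroup.relIndex_comap, AddSubgroup.map_comap_eq_self_of_surjective hβ,
      AddSubgroup.relIndex_bot_left]
  rw [← AddSubgroup.relIndex_bot_left (endKer (α * β)),
    ← AddSubgroup.relIndex_mul_relIndex ⊥ _ _ bot_le hle, AddSubgroup.relIndex_bot_left, h3,
    mul_comm]

theorem card_ker_pow {G : Type*} [AddCommGroup G] (α : AddMonoid.End G)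
    (hα : Function.Surjective α) (n : ℕ) :
    Nat.card (endKer (α ^ n)) =
      Nat.card (endKer α) ^ n := by
  induction n with
  | zero =>
    rw [pow_zero, pow_zero, Nat.card_eq_one_iff_unique]
    exact ⟨⟨fun a b => Subtype.ext ((show a.1 = 0 from a.2).trans (show b.1 = 0 from b.2).symm)⟩,
      ⟨0⟩⟩
  | succ n ih =>
    rw [pow_succ, pow_succ, card_ker_mul (α ^ n) α hα, ih]

end Kernels

/-! ### The kernels of `σ^n - w`. -/

section Eigenspaces

variable {k : Type*} [Field k] [IsAlgClosed k] {σ : k[X]} (hσ : IsAdditivePoly σ)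

local notation "μ" => Module.toAddMonoidEnd k k

omit [IsAlgClosed k] in
theorem toEnd_pow_sub_apply (n : ℕ) (w x : k) :
    (hσ.toEnd ^ n - μ w) x = (σ.comp^[n] X - C w * X).eval x := by
  rw [eval_sub, ← hσ.toEnd_pow_apply, eval_C_mul, eval_X]
  rfl

omit [IsAlgClosed k] in
theorem natDegree_iterate_comp_sub (hdeg : 2 ≤ σ.natDegree) {n : ℕ} (hn : n ≠ 0) (w : k) :
    (σ.comp^[n] X - C w * X).natDegree = σ.natDegree ^ n := by
  have h1 : (σ.comp^[n] X).natDegree = σ.natDegree ^ n := by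
    rw [natDegree_iterate_comp, natDegree_X, mul_one]
  have h2 : 1 < σ.natDegree ^ n := Nat.one_lt_pow hn (by omega)
  rw [natDegree_sub_eq_left_of_natDegree_lt, h1]
  rw [h1]
  exact lt_of_le_of_lt ((natDegree_C_mul_le w X).trans natDegree_X_le) h2

omit [IsAlgClosed k] in
theorem iterate_comp_sub_ne_zero (hdeg : 2 ≤ σ.natDegree) {n : ℕ} (hn : n ≠ 0) (w : k) :
    σ.comp^[n] X - C w * X ≠ 0 := by
  intro h
  have := natDegree_iterate_comp_sub hdeg hn w
  rw [h, natDegree_zero] at this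
  exact (pow_pos (by omega : 0 < σ.natDegree) n).ne this

omit [IsAlgClosed k] in
include hσ in
theorem eval_derivative_iterate_comp_sub (n : ℕ) (w : k) :
    (derivative (σ.comp^[n] X - C w * X)).eval 0 = ((derivative σ).eval 0) ^ n - w := by
  rw [derivative_sub, eval_sub, (eval_derivative_iterate_comp hσ.eval_zero n).2]
  simp

theorem finite_ker_toEnd_pow_sub (hdeg : 2 ≤ σ.natDegree) {n : ℕ} (hn : n ≠ 0) (w : k) :
    (endKer (hσ.toEnd ^ n - μ w) : Set k).Finite :=
  finite_ker _ (toEnd_pow_sub_apply hσ n w) (iterate_comp_sub_ne_zero hdeg hn w)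

theorem surjective_toEnd_pow_sub (hdeg : 2 ≤ σ.natDegree) {n : ℕ} (hn : n ≠ 0) (w : k) :
    Function.Surjective (hσ.toEnd ^ n - μ w) := by
  refine surjective_of_natDegree_ne_zero _ (toEnd_pow_sub_apply hσ n w) ?_
  rw [natDegree_iterate_comp_sub hdeg hn w]
  exact (pow_pos (by omega : 0 < σ.natDegree) n).ne'

theorem card_ker_toEnd_pow_sub_of_ne (hdeg : 2 ≤ σ.natDegree) {n : ℕ} (hn : n ≠ 0) {w : k}
    (hw : ((derivative σ).eval 0) ^ n ≠ w) :
    Nat.card (endKer (hσ.toEnd ^ n - μ w)) = σ.natDegree ^ n := by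
  rw [← natDegree_iterate_comp_sub hdeg hn w]
  refine card_ker_of_eval_derivative_ne_zero _ (toEnd_pow_sub_apply hσ n w) ?_
  rw [eval_derivative_iterate_comp_sub hσ]
  exact sub_ne_zero.2 hw

theorem card_ker_toEnd_pow_sub_lt (hdeg : 2 ≤ σ.natDegree) {n : ℕ} (hn : n ≠ 0) :
    Nat.card (endKer (hσ.toEnd ^ n - μ (((derivative σ).eval 0) ^ n))) <
      σ.natDegree ^ n := by
  rw [← natDegree_iterate_comp_sub hdeg hn (((derivative σ).eval 0) ^ n)]
  refine card_ker_lt_of_eval_derivative_eq_zero _ (toEnd_pow_sub_apply hσ n _)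
    (iterate_comp_sub_ne_zero hdeg hn _) ?_
  rw [eval_derivative_iterate_comp_sub hσ, sub_self]

/-- This is the cofactor of `σ^m - a^m` in `σ^(m(l+1)) - a^(m(l+1))`. Each of its `l + 1` summands
has derivative `a^(ml)` at `0`, so it is separable when `l + 1` is prime to the characteristic, and
its kernel has order equal to its degree. -/
theorem card_ker_geom_sum (hdeg : 2 ≤ σ.natDegree) (ha : (derivative σ).eval 0 ≠ 0) {m : ℕ}
    (hm : m ≠ 0) (l : ℕ) (hl : ((l + 1 : ℕ) : k) ≠ 0) :
    Nat.card (endKer (∑ i ∈ Finset.range (l + 1),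
      μ (((derivative σ).eval 0) ^ m) ^ i * (hσ.toEnd ^ m) ^ (l + 1 - 1 - i))) =
      σ.natDegree ^ (m * l) := by
  set a := (derivative σ).eval 0
  set γ : k[X] := ∑ i ∈ Finset.range (l + 1), C ((a ^ m) ^ (l - i)) * (σ.comp^[m * i] X) with hγ
  have hdegP (i : ℕ) : (σ.comp^[i] X).natDegree = σ.natDegree ^ i := by
    rw [natDegree_iterate_comp, natDegree_X, mul_one]
  have hdegγ : γ.natDegree = σ.natDegree ^ (m * l) := by
    have h1 : (∑ i ∈ Finset.range l, C ((a ^ m) ^ (l - i)) * (σ.comp^[m * i] X)).natDegree ≤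
        σ.natDegree ^ (m * l) - 1 := by
      refine natDegree_sum_le_of_forall_le _ _ fun i hi => ?_
      refine (natDegree_C_mul_le _ _).trans ?_
      rw [hdegP]
      refine Nat.le_sub_one_of_lt (Nat.pow_lt_pow_right (by omega) ?_)
      exact Nat.mul_lt_mul_of_pos_left (Finset.mem_range.1 hi) (Nat.pos_of_ne_zero hm)
    have h2 : 0 < σ.natDegree ^ (m * l) := pow_pos (by omega) _
    rw [hγ, Finset.sum_range_succ, Nat.sub_self, pow_zero, C_1, one_mul,
      natDegree_add_eq_right_of_natDegree_lt, hdegP]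
    rw [hdegP]
    omega
  rw [← hdegγ]
  refine card_ker_of_eval_derivative_ne_zero _ (τ := γ) (fun x => ?_) ?_
  · rw [hγ, eval_finsetSum, ← Finset.sum_range_reflect]
    refine (AddMonoidHom.finsetSum_apply _ _ x).trans (Finset.sum_congr rfl fun i hi => ?_)
    have hi' := Finset.mem_range.1 hi
    have h1 : l - (l - i) = i := by omega
    simp only [Nat.add_sub_cancel, h1, eval_mul, eval_C, ← hσ.toEnd_pow_apply, ← pow_mul]
    show (μ (a ^ m) ^ (l - i)) ((hσ.toEnd ^ (m * i)) x) = _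
    rw [← map_pow μ, ← pow_mul]
    rfl
  · have : (derivative γ).eval 0 = ((l + 1 : ℕ) : k) * (a ^ m) ^ l := by
      rw [hγ, derivative_sum, eval_finsetSum, Finset.sum_congr rfl (g := fun _ => (a ^ m) ^ l),
        Finset.sum_const, Finset.card_range, nsmul_eq_mul]
      intro i hi
      have hi' := Finset.mem_range.1 hi
      rw [derivative_C_mul, eval_C_mul, (eval_derivative_iterate_comp hσ.eval_zero _).2, pow_mul,
        ← pow_add]
      congr 1
      omega
    rw [this]
    exact mul_ne_zero hl (pow_ne_zero _ (pow_ne_zero _ ha))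

/-- If `σ` commutes with multiplication by `w = σ'(0) ^ m`, the number of solutions of
`σ^{mj}(x) = w ^ j x` is governed by the `p`-adic valuation of `j`. -/
theorem card_ker_toEnd_pow_sub (p : ℕ) [Fact p.Prime] [CharP k p] (hdeg : 2 ≤ σ.natDegree)
    (ha : (derivative σ).eval 0 ≠ 0) {m : ℕ} (hm : m ≠ 0)
    (hcomm : ∀ x, σ.eval (((derivative σ).eval 0) ^ m * x) =
      ((derivative σ).eval 0) ^ m * σ.eval x) :
    ∃ S : ℝ, 1 < S ∧ ∀ j : ℕ, j ≠ 0 →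
      (Nat.card (endKer (hσ.toEnd ^ (m * j) - μ (((derivative σ).eval 0) ^ (m * j)))) : ℝ) =
      (σ.natDegree : ℝ) ^ (m * j) * (S ^ p ^ padicValNat p j)⁻¹ := by
  set a := (derivative σ).eval 0 with hadef
  set D := σ.natDegree
  set s := hσ.toEnd
  set T := Nat.card (endKer (s ^ m - μ (a ^ m))) with hT
  have hTlt : T < D ^ m := card_ker_toEnd_pow_sub_lt hσ hdeg hm
  have hTpos : 0 < T := by
    have : Finite (endKer (s ^ m - μ (a ^ m))) :=
      finite_ker_toEnd_pow_sub hσ hdeg hm _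
    exact Nat.card_pos
  have hc : Commute (s ^ m) (μ (a ^ m)) := by
    refine Commute.pow_left ?_ m
    ext x
    exact hcomm x
  have hnt : Nontrivial (AddMonoid.End k) :=
    ⟨0, 1, fun h => zero_ne_one (α := k) (congrArg (fun α : AddMonoid.End k => α 1) h)⟩
  -- The endomorphism ring is noncommutative of characteristic `p`; the Frobenius identity below
  -- still applies to the commuting pair `σ^m`, `a^m`.
  have hchar : CharP (AddMonoid.End k) p :=
    charP_of_injective_ringHom (f := Module.toAddMonoidEnd k k) (RingHom.injective _) p
  have hD0 : (0 : ℝ) < D := by exact_mod_cast (by omega : 0 < D)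
  have hT0 : (0 : ℝ) < T := by exact_mod_cast hTpos
  -- `S` is the ratio of the degree of `σ^m - a^m` to the order of its kernel, and exceeds `1`
  -- because that polynomial is inseparable.
  refine ⟨(D : ℝ) ^ m / T, ?_, fun j hj => ?_⟩
  · rw [one_lt_div hT0]
    exact_mod_cast hTlt
  obtain ⟨q, hq, hjq⟩ : ∃ q, ¬ p ∣ q ∧ j = p ^ padicValNat p j * q := by
    obtain ⟨q, hq⟩ := (pow_padicValNat_dvd : p ^ padicValNat p j ∣ j)
    refine ⟨q, fun ⟨r, hr⟩ => ?_, hq⟩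
    exact pow_succ_padicValNat_not_dvd (p := p) hj ⟨r, by rw [pow_succ, mul_assoc, ← hr, ← hq]⟩
  set e := padicValNat p j
  have hq0 : q ≠ 0 := by rintro rfl; exact hq (dvd_zero p)
  obtain ⟨l, rfl⟩ := Nat.exists_eq_succ_of_ne_zero hq0
  rw [Nat.succ_eq_add_one] at *
  have hfac : s ^ (m * j) - μ (a ^ (m * j)) =
      (s ^ (m * (l + 1)) - μ (a ^ (m * (l + 1)))) ^ p ^ e := by
    have hc' : Commute (s ^ (m * (l + 1))) (μ (a ^ (m * (l + 1)))) := by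
      rw [pow_mul, pow_mul, map_pow μ (a ^ m)]
      exact hc.pow_pow _ _
    rw [sub_pow_char_pow_of_commute p e hc', ← map_pow, ← pow_mul, ← pow_mul, mul_assoc,
      mul_comm (l + 1), ← hjq]
  have hl : ((l + 1 : ℕ) : k) ≠ 0 := by
    rw [Ne, CharP.cast_eq_zero_iff k p]
    exact hq
  set Γ := ∑ i ∈ Finset.range (l + 1), μ (a ^ m) ^ i * (s ^ m) ^ (l + 1 - 1 - i) with hΓ
  have hgeom : s ^ (m * (l + 1)) - μ (a ^ (m * (l + 1))) = Γ * (s ^ m - μ (a ^ m)) := by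
    rw [pow_mul, pow_mul, map_pow μ (a ^ m), hΓ, hc.symm.geom_sum₂_comm, hc.geom_sum₂_mul]
  have hcard : Nat.card (endKer (s ^ (m * (l + 1)) - μ (a ^ (m * (l + 1))))) = D ^ (m * l) * T := by
    have h1 := card_ker_mul Γ (s ^ m - μ (a ^ m)) (surjective_toEnd_pow_sub hσ hdeg hm _)
    rw [hgeom, h1, hΓ, card_ker_geom_sum hσ hdeg ha hm l hl]
  rw [hfac]
  have hpow := card_ker_pow (s ^ (m * (l + 1)) - μ (a ^ (m * (l + 1))))
    (surjective_toEnd_pow_sub hσ hdeg (mul_ne_zero hm l.succ_ne_zero) _) (p ^ e)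
  have hpow' := hpow.trans (congrArg (· ^ p ^ e) hcard)
  have hcast := congrArg (Nat.cast : ℕ → ℝ) hpow'
  refine hcast.trans ?_
  have hexp : (D : ℝ) ^ (m * j) = ((D : ℝ) ^ (m * l) * (D : ℝ) ^ m) ^ p ^ e := by
    rw [← pow_add, ← pow_mul]
    congr 1
    conv_lhs => rw [hjq]
    ring
  rw [hexp]
  push_cast
  rw [← inv_pow, ← mul_pow, inv_div]
  congr 1
  field_simp

end Eigenspaces

/-! ### Periodic points on the quotient by the roots of unity. -/

section Counting

variable {k : Type*} [Field k] [IsAlgClosed k]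

theorem card_nthRoots_toFinset [DecidableEq k] {d : ℕ} (hd : (d : k) ≠ 0) {y : k} (hy : y ≠ 0) :
    (nthRoots d y).toFinset.card = d := by
  have hd0 : d ≠ 0 := by rintro rfl; simp at hd
  have hsep : (X ^ d - C y : k[X]).Separable := separable_X_pow_sub_C y hd hy
  rw [nthRoots, Multiset.toFinset_card_of_nodup (nodup_roots hsep),
    IsAlgClosed.card_roots_eq_natDegree, natDegree_X_pow_sub_C]

/-- If `F (x ^ d) = s(x) ^ d`, then `x ↦ x ^ d` presents the periodic points of `F` as the quotient
of the set of pairs `(w, x)` with `w ^ d = 1` and `s^n(x) = w x`. -/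
theorem mul_ncard_ptsOfPeriod {d : ℕ} (hd : (d : k) ≠ 0) (s : AddMonoid.End k) (F : k → k)
    (hF : ∀ x, F (x ^ d) = s x ^ d) (n : ℕ)
    (hfin : ∀ w : k, w ^ d = 1 →
      (endKer (s ^ n - Module.toAddMonoidEnd k k w) : Set k).Finite) :
    (Function.ptsOfPeriod F n).Finite ∧
      d * (Function.ptsOfPeriod F n).ncard = ∑ w ∈ nthRootsFinset d (1 : k),
        Nat.card (endKer (s ^ n - Module.toAddMonoidEnd k k w)) := by
  classical
  have hd0 : 0 < d := Nat.pos_of_ne_zero (by rintro rfl; simp at hd)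
  have hFn (n : ℕ) (x : k) : F^[n] (x ^ d) = ((s ^ n) x) ^ d := by
    induction n generalizing x with
    | zero => rfl
    | succ n ih =>
      rw [Function.iterate_succ_apply, hF, ih, pow_succ]
      rfl
  have hker (w x : k) : x ∈ (endKer (s ^ n - Module.toAddMonoidEnd k k w)) ↔
      (s ^ n) x = w * x := by
    rw [mem_endKer]
    show (s ^ n) x - w * x = 0 ↔ _
    exact sub_eq_zero
  let K (w : k) : Finset k := if h : w ^ d = 1 then (hfin w h).toFinset else ∅
  have hK {w : k} (hw : w ^ d = 1) (x : k) : x ∈ K w ↔ (s ^ n) x = w * x := by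
    simp only [K, dif_pos hw, Set.Finite.mem_toFinset, SetLike.mem_coe, hker]
  let Z : Finset (Σ _ : k, k) := (nthRootsFinset d (1 : k)).sigma K
  have hZ (z : Σ _ : k, k) : z ∈ Z ↔ z.1 ^ d = 1 ∧ (s ^ n) z.2 = z.1 * z.2 := by
    rw [Finset.mem_sigma, mem_nthRootsFinset hd0]
    exact and_congr_right fun h => hK h _
  let T : Finset k := Z.image fun z => z.2 ^ d
  have hT : Function.ptsOfPeriod F n = (T : Set k) := by
    ext y
    obtain ⟨x, rfl⟩ := IsAlgClosed.exists_pow_nat_eq y hd0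
    simp only [T, Finset.coe_image, Set.mem_image, Finset.mem_coe, hZ, Function.mem_ptsOfPeriod]
    constructor
    · intro h
      have h' : ((s ^ n) x) ^ d = x ^ d := (hFn n x).symm.trans h
      by_cases hx : x = 0
      · subst hx
        exact ⟨⟨1, 0⟩, ⟨one_pow _, by simp⟩, rfl⟩
      · refine ⟨⟨(s ^ n) x / x, x⟩, ⟨?_, ?_⟩, rfl⟩
        · rw [div_pow, h', div_self (pow_ne_zero _ hx)]
        · exact (div_mul_cancel₀ _ hx).symm
    · rintro ⟨⟨w, z⟩, ⟨hw, hz⟩, hzx⟩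
      dsimp only at hw hz hzx
      show F^[n] (x ^ d) = x ^ d
      rw [← hzx, hFn, hz, mul_pow, hw, one_mul]
  refine ⟨hT ▸ T.finite_toSet, ?_⟩
  have hcardZ : Z.card = ∑ w ∈ nthRootsFinset d (1 : k),
      Nat.card (endKer (s ^ n - Module.toAddMonoidEnd k k w)) := by
    rw [Finset.card_sigma]
    refine Finset.sum_congr rfl fun w hw => ?_
    have hw' := (mem_nthRootsFinset hd0 _).1 hw
    rw [← SetLike.coe_sort_coe, Nat.card_coe_set_eq, ← Set.ncard_coe_finset]
    congr 1
    ext x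
    rw [Finset.mem_coe, hK hw', SetLike.mem_coe, hker]
  -- Every fibre of `(w, x) ↦ x ^ d` on `Z` has `d` elements: over `0` they are the pairs `(w, 0)`;
  -- over `y ≠ 0`, the `d` roots `x` of `y`, each determining `w = s^n(x) / x`.
  rw [← hcardZ, hT, Set.ncard_coe_finset,
    Finset.card_eq_sum_card_fiberwise (f := fun z : Σ _ : k, k => z.2 ^ d) (t := T)
      (fun z hz => Finset.mem_coe.2 (Finset.mem_image_of_mem _ (Finset.mem_coe.1 hz))),
    Finset.sum_congr rfl (g := fun _ => d), Finset.sum_const, smul_eq_mul, mul_comm]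
  intro y hy
  by_cases hy0 : y = 0
  · subst hy0
    have hone : (nthRootsFinset d (1 : k)).card = d :=
      card_nthRoots_toFinset hd one_ne_zero
    refine Eq.trans ?_ hone
    refine Finset.card_nbij' (fun z => z.1) (fun w => ⟨w, 0⟩) ?_ ?_ ?_ ?_
    · intro z hz
      simp only [Finset.coe_filter, Set.mem_ofPred_eq, hZ] at hz
      exact Finset.mem_coe.2 ((mem_nthRootsFinset hd0 _).2 hz.1.1)
    · intro w hw
      simp only [Finset.coe_filter, Set.mem_ofPred_eq, hZ]
      exact ⟨⟨(mem_nthRootsFinset hd0 _).1 (Finset.mem_coe.1 hw), by simp⟩, zero_pow hd0.ne'⟩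
    · rintro ⟨w, x⟩ hz
      simp only [Finset.coe_filter, Set.mem_ofPred_eq, hZ] at hz
      have : x = 0 := pow_eq_zero_iff hd0.ne' |>.1 hz.2
      rw [this]
    · exact fun _ _ => rfl
  · obtain ⟨⟨w₀, x₀⟩, hz₀, hzy⟩ := Finset.mem_image.1 hy
    rw [hZ] at hz₀
    have hper : ∀ x : k, x ^ d = y → ((s ^ n) x) ^ d = y := by
      intro x hx
      rw [← hFn, hx, ← hzy, hFn, hz₀.2, mul_pow, hz₀.1, one_mul]
    have hne {x : k} (hx : x ^ d = y) : x ≠ 0 := by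
      rintro rfl
      exact hy0 (hx ▸ zero_pow hd0.ne')
    refine Eq.trans ?_ (card_nthRoots_toFinset hd hy0)
    refine Finset.card_nbij' (fun z => z.2) (fun x => ⟨(s ^ n) x / x, x⟩) ?_ ?_ ?_ ?_
    · intro z hz
      simp only [Finset.coe_filter, Set.mem_ofPred_eq, hZ] at hz
      simp only [Finset.mem_coe, Multiset.mem_toFinset, mem_nthRoots hd0]
      exact hz.2
    · intro x hx
      simp only [Finset.mem_coe, Multiset.mem_toFinset, mem_nthRoots hd0] at hx
      simp only [Finset.coe_filter, Set.mem_ofPred_eq, hZ]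
      refine ⟨⟨?_, (div_mul_cancel₀ _ (hne hx)).symm⟩, hx⟩
      rw [div_pow, hper x hx, hx, div_self hy0]
    · rintro ⟨w, x⟩ hz
      simp only [Finset.coe_filter, Set.mem_ofPred_eq, hZ] at hz
      dsimp only
      rw [hz.1.2, mul_div_cancel_right₀ _ (hne hz.2)]
    · exact fun _ _ => rfl

end Counting

/-! ### Period counts in terms of `σ'(0)`. -/

section PeriodCounts

variable {k : Type*} [Field k] [IsAlgClosed k]

theorem IsAdditivePoly.finite_ptsOfPeriod {σ : k[X]} (hσ : IsAdditivePoly σ)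
    (hdeg : 2 ≤ σ.natDegree) {d : ℕ} (hd : (d : k) ≠ 0) {F : k → k}
    (hF : ∀ x, F (x ^ d) = σ.eval x ^ d) {n : ℕ} (hn : n ≠ 0) :
    (Function.ptsOfPeriod F n).Finite ∧
      d * (Function.ptsOfPeriod F n).ncard = ∑ w ∈ nthRootsFinset d (1 : k),
        Nat.card (endKer (hσ.toEnd ^ n - Module.toAddMonoidEnd k k w)) :=
  mul_ncard_ptsOfPeriod hd hσ.toEnd F hF n fun w _ => finite_ker_toEnd_pow_sub hσ hdeg hn w

theorem card_nthRootsFinset_one {d : ℕ} (hd : (d : k) ≠ 0) :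
    (nthRootsFinset d (1 : k)).card = d := by
  classical
  exact card_nthRoots_toFinset hd one_ne_zero

theorem IsAdditivePoly.ncard_ptsOfPeriod_of_ne {σ : k[X]} (hσ : IsAdditivePoly σ)
    (hdeg : 2 ≤ σ.natDegree) {d : ℕ} (hd : (d : k) ≠ 0) {F : k → k}
    (hF : ∀ x, F (x ^ d) = σ.eval x ^ d) {n : ℕ} (hn : n ≠ 0)
    (hne : (((derivative σ).eval 0) ^ d) ^ n ≠ 1) :
    (Function.ptsOfPeriod F n).ncard = σ.natDegree ^ n := by
  have hd0 : 0 < d := Nat.pos_of_ne_zero (by rintro rfl; simp at hd)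
  have h := (hσ.finite_ptsOfPeriod hdeg hd hF hn).2
  rw [Finset.sum_congr rfl (g := fun _ => σ.natDegree ^ n), Finset.sum_const,
    card_nthRootsFinset_one hd, smul_eq_mul] at h
  · exact Nat.eq_of_mul_eq_mul_left hd0 h
  · intro w hw
    refine card_ker_toEnd_pow_sub_of_ne hσ hdeg hn fun h => hne ?_
    rw [← pow_mul, mul_comm, pow_mul, h]
    exact (mem_nthRootsFinset hd0 _).1 hw

/-- Only `w = a^(mj)` gives a deficient kernel; the other `d - 1` roots of unity each contribute the
full degree. Dividing the total by `d` puts the factor `d⁻¹` on the defect. -/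
theorem IsAdditivePoly.exists_ncard_ptsOfPeriod {σ : k[X]} (hσ : IsAdditivePoly σ)
    (p : ℕ) [Fact p.Prime] [CharP k p] (hdeg : 2 ≤ σ.natDegree)
    (ha : (derivative σ).eval 0 ≠ 0) {d : ℕ} (hd : (d : k) ≠ 0)
    (hcomm : ∀ w : k, w ^ d = 1 → ∀ x, σ.eval (w * x) = w * σ.eval x) {F : k → k}
    (hF : ∀ x, F (x ^ d) = σ.eval x ^ d) {m : ℕ} (hm : m ≠ 0)
    (h1 : (((derivative σ).eval 0) ^ d) ^ m = 1) :
    ∃ S : ℝ, 1 < S ∧ ∀ j : ℕ, j ≠ 0 →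
      ((Function.ptsOfPeriod F (m * j)).ncard : ℝ) = (σ.natDegree : ℝ) ^ (m * j) -
        (d : ℝ)⁻¹ * (σ.natDegree : ℝ) ^ (m * j) * (1 - (S ^ p ^ padicValNat p j)⁻¹) := by
  have hd0 : 0 < d := Nat.pos_of_ne_zero (by rintro rfl; simp at hd)
  have hroot : (((derivative σ).eval 0) ^ m) ^ d = 1 := by
    rw [← pow_mul, mul_comm, pow_mul, h1]
  obtain ⟨S, hS, hcard⟩ := card_ker_toEnd_pow_sub hσ p hdeg ha hm (hcomm _ hroot)
  refine ⟨S, hS, fun j hj => ?_⟩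
  have h := (hσ.finite_ptsOfPeriod hdeg hd hF (mul_ne_zero hm hj)).2
  have hmem : ((derivative σ).eval 0) ^ (m * j) ∈ nthRootsFinset d (1 : k) := by
    rw [mem_nthRootsFinset hd0, pow_mul, ← pow_mul, mul_comm, pow_mul, hroot, one_pow]
  have h' := congrArg (Nat.cast : ℕ → ℝ) h
  push_cast at h'
  classical
  rw [← Finset.add_sum_erase _ _ hmem, hcard j hj,
    Finset.sum_congr rfl (g := fun _ => (σ.natDegree : ℝ) ^ (m * j)), Finset.sum_const,
    Finset.card_erase_of_mem hmem, card_nthRootsFinset_one hd, nsmul_eq_mul,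
    Nat.cast_sub hd0, Nat.cast_one] at h'
  · have hdR : (d : ℝ) ≠ 0 := by exact_mod_cast hd0.ne'
    generalize (S ^ p ^ padicValNat p j)⁻¹ = T at h' ⊢
    field_simp
    linear_combination h'
  · intro w hw
    rw [card_ker_toEnd_pow_sub_of_ne hσ hdeg (mul_ne_zero hm hj) (Finset.ne_of_mem_erase hw).symm]
    push_cast
    rfl

end PeriodCounts

/-! ### Reduction of affine and subadditive polynomials to additive ones. -/

section Presentation

variable {k : Type*} [Field k] [IsAlgClosed k]

/-- `f` is, up to the bijection `e`, the map induced by the additive polynomial `σ` on the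
quotient by the group of `d`-th roots of unity. -/
structure IsQuotientOfAdditive (f : k[X]) (d : ℕ) (σ : k[X]) (e : k ≃ k) : Prop where
  additive : IsAdditivePoly σ
  two_le : 2 ≤ σ.natDegree
  cast_ne_zero : (d : k) ≠ 0
  eval_derivative_ne_zero : (derivative σ).eval 0 ≠ 0
  comm : ∀ w : k, w ^ d = 1 → ∀ x, σ.eval (w * x) = w * σ.eval x
  eval_eq : ∀ x, f.eval (e (x ^ d)) = e (σ.eval x ^ d)
  eval_derivative_eq : (derivative f).eval 0 = ((derivative σ).eval 0) ^ d
  natDegree_eq : f.natDegree = σ.natDegree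

/-- `f` has a fixed point `z` since `σ - X + c` is nonconstant; translating `z` to the origin
conjugates `f` to `σ`. -/
theorem isQuotientOfAdditive_of_affine {f : k[X]} (hf : IsAffineAdditivePoly f)
    (hsep : derivative f ≠ 0) : ∃ σ e, IsQuotientOfAdditive f 1 σ e := by
  have : Infinite k := IsAlgClosed.instInfinite
  obtain ⟨σ, c, hσ, hdeg, rfl⟩ := hf
  have hd : derivative (σ + C c) = derivative σ := by simp
  have hnd : (σ - X).natDegree = σ.natDegree :=
    natDegree_sub_eq_left_of_natDegree_lt (by rw [natDegree_X]; omega)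
  have hdeg' : 0 < (σ - X + C c).natDegree := by rw [natDegree_add_C, hnd]; omega
  obtain ⟨z, hz⟩ := IsAlgClosed.exists_root (σ - X + C c)
    (natDegree_pos_iff_degree_pos.1 hdeg').ne'
  have hz' : σ.eval z + c = z := by
    simp only [IsRoot, eval_add, eval_sub, eval_X, eval_C] at hz
    linear_combination hz
  refine ⟨σ, Equiv.addRight z, hσ, hdeg, by simp, ?_, ?_, ?_, ?_, ?_⟩
  · intro h0
    rw [hd, hσ.derivative_eq_C, h0, C_0] at hsep
    exact hsep rfl
  · intro w hw x
    rw [pow_one] at hw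
    simp [hw]
  · intro x
    rw [Equiv.coe_addRight, pow_one, pow_one, eval_add, eval_C, hσ, add_assoc, hz']
  · rw [hd, pow_one]
  · rw [natDegree_add_C]

/-- The `d`-th powers of `ψ(w x)` and `ψ(x)` agree, where `ψ = σ + c`, so `ψ(w x) = χ ψ(x)` for some
`d`-th root of unity `χ`; comparing derivatives at `0` forces `χ = w`. -/
theorem eval_mul_root_of_comp_eq_pow {f : k[X]} {d : ℕ} (hd : (d : k) ≠ 0)
    {σ : k[X]} (ha : (derivative σ).eval 0 ≠ 0) (c : k)
    (h : f.comp (X ^ d) = (σ + C c) ^ d) {w : k} (hw : w ^ d = 1) :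
    (σ + C c).comp (C w * X) = C w * (σ + C c) := by
  have : Infinite k := IsAlgClosed.instInfinite
  have hd0 : 0 < d := Nat.pos_of_ne_zero (by rintro rfl; simp at hd)
  have : NeZero (d : k) := ⟨hd⟩
  obtain ⟨ζ, hζ⟩ := HasEnoughRootsOfUnity.exists_primitiveRoot k d
  have hζ' : IsPrimitiveRoot (C ζ : k[X]) d := hζ.map_of_injective C_injective
  have hpow : ((σ + C c).comp (C w * X)) ^ d = (σ + C c) ^ d := by
    rw [← pow_comp, ← h, comp_assoc, pow_comp, X_comp, mul_pow, ← C_pow, hw, C_1, one_mul]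
  have hprod := hζ'.pow_sub_pow_eq_prod_sub_mul ((σ + C c).comp (C w * X)) (σ + C c) hd0
  rw [hpow, sub_self, eq_comm, Finset.prod_eq_zero_iff] at hprod
  obtain ⟨χ, hχ, hχ'⟩ := hprod
  rw [mem_nthRootsFinset hd0] at hχ
  obtain ⟨u, -, rfl⟩ := isUnit_iff.1 (IsUnit.of_pow_eq_one hχ hd0.ne')
  have hder := congrArg (fun q => (derivative q).eval 0) (sub_eq_zero.1 hχ')
  simp only [derivative_comp, derivative_C_mul, derivative_X, eval_mul, eval_comp, eval_C, eval_X,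
    derivative_add, derivative_C, add_zero, mul_zero, mul_one] at hder
  rw [sub_eq_zero.1 hχ', mul_right_cancel₀ ha hder]

theorem isQuotientOfAdditive_of_subadditive (p : ℕ) [Fact p.Prime] [CharP k p] {f : k[X]}
    (hf : IsSubadditivePoly p f) (hsep : derivative f ≠ 0) :
    ∃ d σ, IsQuotientOfAdditive f d σ (Equiv.refl k) := by
  have : Infinite k := IsAlgClosed.instInfinite
  obtain ⟨d, ψ, hd1, hpd, ⟨σ, c, hσ, hdeg, rfl⟩, hcomp⟩ := hf
  have hd : (d : k) ≠ 0 := by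
    rw [Ne, CharP.cast_eq_zero_iff k p]
    exact fun h => (Fact.out : p.Prime).one_lt.ne'
      (Nat.dvd_one.1 (hpd.gcd_eq_one ▸ Nat.dvd_gcd dvd_rfl h))
  have hd0 : 0 < d := by omega
  have hder := congrArg derivative hcomp
  rw [derivative_comp, derivative_X_pow, derivative_pow, derivative_add, derivative_C,
    add_zero, hσ.derivative_eq_C] at hder
  have hXd : (X ^ d : k[X]).natDegree ≠ 0 := by rw [natDegree_X_pow]; omega
  have hdC : (C (d : k)) ≠ 0 := C_ne_zero.2 hd
  have ha : (derivative σ).eval 0 ≠ 0 := by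
    intro h0
    rw [h0, C_0, mul_zero] at hder
    have hne : (derivative f).comp (X ^ d) ≠ 0 := fun h => by
      rcases comp_eq_zero_iff.1 h with h | ⟨-, h⟩
      · exact hsep h
      · rw [h, natDegree_C] at hXd
        exact hXd rfl
    exact (mul_ne_zero (mul_ne_zero hdC (pow_ne_zero _ X_ne_zero)) hne) hder
  have hroot {w : k} (hw : w ^ d = 1) := eval_mul_root_of_comp_eq_pow hd ha c hcomp hw
  -- At `x = 0`, equivariance under a primitive root `ζ ≠ 1` reads `c = ζ c`.
  have hc : c = 0 := by
    have : NeZero (d : k) := ⟨hd⟩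
    obtain ⟨ζ, hζ⟩ := HasEnoughRootsOfUnity.exists_primitiveRoot k d
    have h := congrArg (eval 0) (hroot hζ.pow_eq_one)
    simp only [eval_comp, eval_add, eval_mul, eval_C, eval_X, mul_zero, hσ.eval_zero,
      zero_add] at h
    have h' : (1 - ζ) * c = 0 := by linear_combination h
    exact (mul_eq_zero.1 h').resolve_left (sub_ne_zero.2 (hζ.ne_one hd1).symm)
  subst hc
  simp only [C_0, add_zero] at *
  refine ⟨d, σ, hσ, hdeg, hd, ha, ?_, ?_, ?_, ?_⟩
  · intro w hw x
    simpa using congrArg (eval x) (hroot hw)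
  · intro x
    simpa using congrArg (eval x) hcomp
  -- The differentiated relation has a factor `x^(d-1)` on both sides, as `σ = x g`. Cancelling it
  -- before setting `x = 0` gives `f'(0) = g(0)^(d-1) a = a^d`.
  · obtain ⟨g, hg⟩ := X_dvd_iff.2 (coeff_zero_eq_eval_zero σ ▸ hσ.eval_zero)
    have hg0 : (derivative σ).eval 0 = g.eval 0 := by rw [hg]; simp
    have h1 : C (d : k) * X ^ (d - 1) * (derivative f).comp (X ^ d) =
        C (d : k) * X ^ (d - 1) * (g ^ (d - 1) * C ((derivative σ).eval 0)) := by
      rw [hder]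
      conv_lhs => rw [show σ ^ (d - 1) = (X * g) ^ (d - 1) from by rw [← hg]]
      ring
    have h2 := mul_left_cancel₀ (mul_ne_zero hdC (pow_ne_zero _ X_ne_zero)) h1
    have h3 := congrArg (eval 0) h2
    simp only [eval_comp, eval_pow, eval_X, eval_mul, eval_C, zero_pow hd0.ne', ← hg0] at h3
    rw [h3, ← pow_succ, Nat.sub_add_cancel hd0]
  · have := congrArg natDegree hcomp
    rw [natDegree_comp, natDegree_X_pow, natDegree_pow, mul_comm] at this
    exact Nat.eq_of_mul_eq_mul_left hd0 this

omit [IsAlgClosed k] in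
theorem ptsOfPeriod_polyMapP1 (f : k[X]) (n : ℕ) :
    Function.ptsOfPeriod (polyMapP1 f) n =
      insert OnePoint.infty (OnePoint.some '' Function.ptsOfPeriod (fun x => f.eval x) n) := by
  have h1 : (polyMapP1 f)^[n] OnePoint.infty = OnePoint.infty :=
    Function.iterate_fixed rfl n
  have h2 (x : k) : (polyMapP1 f)^[n] (x : OnePoint k) =
      (((fun x => f.eval x)^[n] x : k) : OnePoint k) :=
    (Function.Semiconj.iterate_right (f := OnePoint.some) (ga := fun x => f.eval x)
      (gb := polyMapP1 f) (fun _ => rfl) n x).symm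
  ext x
  induction x using OnePoint.rec with
  | infty => simpa [Function.IsPeriodicPt, Function.IsFixedPt] using h1
  | coe x =>
    rw [Function.mem_ptsOfPeriod, Function.IsPeriodicPt, Function.IsFixedPt, h2]
    simp [Function.IsPeriodicPt, Function.IsFixedPt]

namespace IsQuotientOfAdditive

variable {f : k[X]} {d : ℕ} {σ : k[X]} {e : k ≃ k}

/-- The map conjugate to `f` by `e`. -/
def conj (_ : IsQuotientOfAdditive f d σ e) (x : k) : k := e.symm (f.eval (e x))

omit [IsAlgClosed k] in
theorem conj_pow (h : IsQuotientOfAdditive f d σ e) (x : k) :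
    h.conj (x ^ d) = σ.eval x ^ d := by
  rw [conj, h.eval_eq, e.symm_apply_apply]

omit [IsAlgClosed k] in
theorem ptsOfPeriod_eq (h : IsQuotientOfAdditive f d σ e) (n : ℕ) :
    Function.ptsOfPeriod (fun x => f.eval x) n = e '' Function.ptsOfPeriod h.conj n := by
  have hs : Function.Semiconj e h.conj (fun x => f.eval x) := fun x => by
    simp [conj]
  ext y
  obtain ⟨x, rfl⟩ := e.surjective y
  rw [e.injective.mem_set_image, Function.mem_ptsOfPeriod, Function.mem_ptsOfPeriod,
    Function.IsPeriodicPt, Function.IsFixedPt, ← (hs.iterate_right n) x, e.injective.eq_iff]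
  rfl

theorem finite_ptsOfPeriod_conj (h : IsQuotientOfAdditive f d σ e) {n : ℕ} (hn : n ≠ 0) :
    (Function.ptsOfPeriod h.conj n).Finite :=
  (h.additive.finite_ptsOfPeriod h.two_le h.cast_ne_zero h.conj_pow hn).1

theorem finite_ptsOfPeriod (h : IsQuotientOfAdditive f d σ e) {n : ℕ} (hn : n ≠ 0) :
    (Function.ptsOfPeriod (polyMapP1 f) n).Finite := by
  rw [ptsOfPeriod_polyMapP1, h.ptsOfPeriod_eq]
  exact (((h.finite_ptsOfPeriod_conj hn).image _).image _).insert _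

theorem ncard_ptsOfPeriod (h : IsQuotientOfAdditive f d σ e) {n : ℕ} (hn : n ≠ 0) :
    (Function.ptsOfPeriod (polyMapP1 f) n).ncard = 1 + (Function.ptsOfPeriod h.conj n).ncard := by
  rw [ptsOfPeriod_polyMapP1, h.ptsOfPeriod_eq, Set.ncard_insert_of_notMem (by simp)
    (((h.finite_ptsOfPeriod_conj hn).image _).image _),
    Set.ncard_image_of_injective _ OnePoint.coe_injective,
    Set.ncard_image_of_injective _ e.injective, add_comm]

theorem ncard_ptsOfPeriod_of_ne (h : IsQuotientOfAdditive f d σ e) {n : ℕ} (hn : n ≠ 0)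
    (hne : ((derivative f).eval 0) ^ n ≠ 1) :
    (Function.ptsOfPeriod (polyMapP1 f) n).ncard = 1 + f.natDegree ^ n := by
  rw [h.ncard_ptsOfPeriod hn, h.natDegree_eq]
  rw [h.eval_derivative_eq] at hne
  rw [h.additive.ncard_ptsOfPeriod_of_ne h.two_le h.cast_ne_zero h.conj_pow hn hne]

theorem exists_ncard_ptsOfPeriod (h : IsQuotientOfAdditive f d σ e) (p : ℕ) [Fact p.Prime]
    [CharP k p] {m : ℕ} (hm : m ≠ 0) (h1 : ((derivative f).eval 0) ^ m = 1) :
    ∃ S : ℝ, 1 < S ∧ ∀ j : ℕ, j ≠ 0 →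
      ((Function.ptsOfPeriod (polyMapP1 f) (m * j)).ncard : ℝ) = 1 + (f.natDegree : ℝ) ^ (m * j) -
        (d : ℝ)⁻¹ * (f.natDegree : ℝ) ^ (m * j) * (1 - (S ^ p ^ padicValNat p j)⁻¹) := by
  rw [h.eval_derivative_eq] at h1
  obtain ⟨S, hS, hcard⟩ := h.additive.exists_ncard_ptsOfPeriod p h.two_le
    h.eval_derivative_ne_zero h.cast_ne_zero h.comm h.conj_pow hm h1
  refine ⟨S, hS, fun j hj => ?_⟩
  rw [h.ncard_ptsOfPeriod (mul_ne_zero hm hj), Nat.cast_add, hcard j hj, h.natDegree_eq]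
  push_cast
  ring

end IsQuotientOfAdditive

end Presentation

/-! ### Algebraic elements over a finite field are roots of unity. -/

theorem exists_pow_eq_one_of_isAlgebraic {F K : Type*} [Field F] [Finite F] [Field K] [Algebra F K]
    {a : K} (ha : IsAlgebraic F a) (h0 : a ≠ 0) : ∃ n : ℕ, n ≠ 0 ∧ a ^ n = 1 := by
  have : FiniteDimensional F (IntermediateField.adjoin F {a}) :=
    IntermediateField.adjoin.finiteDimensional ha.isIntegral
  have : Finite (IntermediateField.adjoin F {a}) := Module.finite_of_finite F
  let u : (IntermediateField.adjoin F {a})ˣ :=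
    Units.mk0 ⟨a, IntermediateField.mem_adjoin_simple_self F a⟩
      (fun h => h0 (congrArg Subtype.val h))
  have h := MonoidHom.isOfFinOrder ((algebraMap (IntermediateField.adjoin F {a}) K : _ →* K).comp
    (Units.coeHom _)) (isOfFinOrder_of_finite u)
  obtain ⟨n, hn, h1⟩ := isOfFinOrder_iff_pow_eq_one.1 h
  exact ⟨n, hn.ne', h1⟩

theorem pow_ne_one_of_transcendental {F K : Type*} [Field F] [Field K] [Algebra F K]
    {a : K} (ha : Transcendental F a) {n : ℕ} (hn : n ≠ 0) : a ^ n ≠ 1 := fun h =>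
  ha (IsAlgebraic.of_pow (Nat.pos_of_ne_zero hn) (h ▸ isAlgebraic_one))

/-! ### Algebraicity of the logarithmic derivative. -/

section LogDerivative

/-- Chain rule; `Q` is `P` with its coefficients differentiated. -/
theorem exists_derivative_aeval_powerSeries {F : Type*} [Field F] (z : PowerSeries F)
    (P : F[X][X]) : ∃ Q : F[X][X], PowerSeries.derivative F (aeval z P) =
      aeval z Q + aeval z (derivative P) * PowerSeries.derivative F z := by
  induction P using Polynomial.induction_on' with
  | add p q hp hq =>
    obtain ⟨Q₁, h₁⟩ := hp
    obtain ⟨Q₂, h₂⟩ := hq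
    refine ⟨Q₁ + Q₂, ?_⟩
    simp only [map_add, h₁, h₂]
    ring
  | monomial n a =>
    refine ⟨monomial n (derivative a), ?_⟩
    have ha : PowerSeries.derivative F (algebraMap F[X] (PowerSeries F) a) =
        algebraMap F[X] (PowerSeries F) (derivative a) := PowerSeries.derivative_coe a
    rw [derivative_monomial, aeval_monomial, aeval_monomial, aeval_monomial, Derivation.leibniz,
      Derivation.leibniz_pow, ha]
    simp only [smul_eq_mul, nsmul_eq_mul, map_mul, map_natCast]
    ring

/-- Differentiating `P(z) = 0` gives `P'(z) z' = -Q(z)`, which determines `z'` if `P'(z) ≠ 0`;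
otherwise `P'` is an equation for `z` of smaller degree. -/
theorem isAlgebraic_derivative_powerSeries {F : Type*} [Field F] [CharZero F] {z : PowerSeries F}
    (h : IsAlgebraic F[X] z) : IsAlgebraic F[X] (PowerSeries.derivative F z) := by
  obtain ⟨P, hP, hz⟩ := h
  induction hn : P.natDegree using Nat.strong_induction_on generalizing P with
  | _ n ih =>
  by_cases hP' : derivative P = 0
  · rw [eq_C_of_derivative_eq_zero hP', aeval_C] at hz
    have : P.coeff 0 = 0 := Polynomial.coe_injective F (hz.trans Polynomial.coe_zero.symm)
    rw [eq_C_of_derivative_eq_zero hP', this, C_0] at hP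
    exact absurd rfl hP
  by_cases hz' : aeval z (derivative P) = 0
  · refine ih _ ?_ _ hP' hz' rfl
    rw [← hn]
    refine natDegree_derivative_lt fun h0 => hP' ?_
    rw [eq_C_of_natDegree_eq_zero h0, derivative_C]
  · obtain ⟨Q, hQ⟩ := exists_derivative_aeval_powerSeries z P
    rw [hz, map_zero] at hQ
    have halg (R : F[X][X]) : IsAlgebraic F[X] (aeval z R) := by
      have hmem : z ∈ Subalgebra.algebraicClosure F[X] (PowerSeries F) := ⟨P, hP, hz⟩
      rw [aeval_eq_sum_range]
      exact Subalgebra.sum_mem _ fun i _ => Subalgebra.smul_mem _ (pow_mem hmem i) _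
    refine IsAlgebraic.of_mul (mem_nonZeroDivisors_of_ne_zero hz') (halg _) ?_
    rw [← neg_eq_of_add_eq_zero_right hQ.symm]
    exact (halg Q).neg

theorem constantCoeff_artinMazurExponent {Y : Type*} (f : Y → Y) :
    PowerSeries.constantCoeff (artinMazurExponent f) = 0 := by
  rw [← PowerSeries.coeff_zero_eq_constantCoeff_apply, artinMazurExponent, PowerSeries.coeff_mk,
    if_pos rfl]

theorem constantCoeff_artinMazurZeta {Y : Type*} (f : Y → Y) :
    PowerSeries.constantCoeff (artinMazurZeta f) = 1 := by
  have h := PowerSeries.constantCoeff_subst (artinMazurExponent_hasSubst f) (PowerSeries.exp ℚ)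
  refine h.trans ?_
  rw [finsum_eq_single _ 0]
  · simp
  · intro n hn
    rw [map_pow, show MvPowerSeries.constantCoeff (artinMazurExponent f) = 0 from
      constantCoeff_artinMazurExponent f, zero_pow hn, smul_zero]

theorem derivative_artinMazurZeta {Y : Type*} (f : Y → Y) :
    PowerSeries.derivative ℚ (artinMazurZeta f) = artinMazurZeta f *
      PowerSeries.mk fun n => ((Function.ptsOfPeriod f (n + 1)).ncard : ℚ) := by
  rw [artinMazurZeta, PowerSeries.derivative_subst (artinMazurExponent_hasSubst f),
    PowerSeries.derivative_exp]
  congr 1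
  ext n
  rw [PowerSeries.coeff_derivative, artinMazurExponent, PowerSeries.coeff_mk, PowerSeries.coeff_mk,
    if_neg n.succ_ne_zero]
  have : (n : ℚ) + 1 ≠ 0 := by positivity
  push_cast
  field_simp

theorem isAlgebraic_of_isAlgebraic_artinMazurZeta {Y : Type*} (f : Y → Y)
    (h : IsAlgebraic ℚ[X] (artinMazurZeta f)) : IsAlgebraic ℚ[X]
      (PowerSeries.mk fun n => if n = 0 then 0 else ((Function.ptsOfPeriod f n).ncard : ℚ)) := by
  have h0 : artinMazurZeta f ≠ 0 := fun h0 => by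
    have := constantCoeff_artinMazurZeta f
    rw [h0, map_zero] at this
    exact zero_ne_one this
  have h1 := isAlgebraic_derivative_powerSeries h
  rw [derivative_artinMazurZeta] at h1
  have h2 := IsAlgebraic.of_mul (mem_nonZeroDivisors_of_ne_zero h0) h h1
  have hX : IsAlgebraic ℚ[X] (PowerSeries.X : PowerSeries ℚ) := by
    have := isAlgebraic_algebraMap (A := PowerSeries ℚ) (X : ℚ[X])
    rwa [show algebraMap ℚ[X] (PowerSeries ℚ) X = PowerSeries.X from Polynomial.coe_X] at this
  have heq : (PowerSeries.mk fun n =>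
      if n = 0 then 0 else ((Function.ptsOfPeriod f n).ncard : ℚ)) = PowerSeries.X *
        PowerSeries.mk fun n => ((Function.ptsOfPeriod f (n + 1)).ncard : ℚ) := by
    refine PowerSeries.ext fun n => ?_
    cases n with
    | zero => simp
    | succ n => simp [PowerSeries.coeff_succ_X_mul]
  rw [heq]
  exact hX.mul h2

end LogDerivative

/-! ### Complex values of power series, and blow-up of algebraic ones. -/

section Evaluation

/-- The power series `g` converges absolutely at `z`, with sum `v`. -/
def EvalsTo (z : ℂ) (g : PowerSeries ℚ) (v : ℂ) : Prop :=
  (Summable fun n => ‖((PowerSeries.coeff n g : ℚ) : ℂ) * z ^ n‖) ∧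
    ∑' n, ((PowerSeries.coeff n g : ℚ) : ℂ) * z ^ n = v

namespace EvalsTo

variable {z v w : ℂ} {g h : PowerSeries ℚ}

theorem coe (z : ℂ) (q : ℚ[X]) : EvalsTo z (q : PowerSeries ℚ) (aeval z q) := by
  have h0 : ∀ n ∉ q.support, ((PowerSeries.coeff n (q : PowerSeries ℚ) : ℚ) : ℂ) * z ^ n = 0 := by
    intro n hn
    rw [Polynomial.coeff_coe, notMem_support_iff.1 hn, Rat.cast_zero, zero_mul]
  refine ⟨summable_of_ne_finset_zero (s := q.support) fun n hn => ?_, ?_⟩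
  · rw [h0 n hn, norm_zero]
  · rw [tsum_eq_sum h0, aeval_eq_sum_range' q.natDegree.lt_succ_self]
    refine Finset.sum_subset_zero_on_sdiff (fun n hn => ?_) (fun n hn => ?_) (fun n _ => ?_)
    · exact Finset.mem_range.2 (Nat.lt_succ_of_le (le_natDegree_of_mem_supp n hn))
    · rw [notMem_support_iff.1 (Finset.mem_sdiff.1 hn).2, zero_smul]
    · rw [Polynomial.coeff_coe, Algebra.smul_def]
      rfl

theorem add (hg : EvalsTo z g v) (hh : EvalsTo z h w) : EvalsTo z (g + h) (v + w) := by
  have key (n : ℕ) : ((PowerSeries.coeff n (g + h) : ℚ) : ℂ) * z ^ n =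
      ((PowerSeries.coeff n g : ℚ) : ℂ) * z ^ n + ((PowerSeries.coeff n h : ℚ) : ℂ) * z ^ n := by
    rw [map_add]
    push_cast
    ring
  simp only [EvalsTo, key]
  refine ⟨Summable.of_nonneg_of_le (fun _ => norm_nonneg _) (fun _ => norm_add_le _ _)
    (hg.1.add hh.1), ?_⟩
  rw [hg.1.of_norm.tsum_add hh.1.of_norm, hg.2, hh.2]

theorem mul (hg : EvalsTo z g v) (hh : EvalsTo z h w) : EvalsTo z (g * h) (v * w) := by
  set a : ℕ → ℂ := fun n => ((PowerSeries.coeff n g : ℚ) : ℂ) * z ^ n with ha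
  set b : ℕ → ℂ := fun n => ((PowerSeries.coeff n h : ℚ) : ℂ) * z ^ n with hb
  have hsa : Summable fun n => ‖a n‖ := hg.1
  have hsb : Summable fun n => ‖b n‖ := hh.1
  have key : (fun n => ((PowerSeries.coeff n (g * h) : ℚ) : ℂ) * z ^ n) =
      fun n => ∑ kl ∈ Finset.HasAntidiagonal.antidiagonal n, a kl.1 * b kl.2 := by
    funext n
    rw [PowerSeries.coeff_mul, Rat.cast_sum, Finset.sum_mul]
    refine Finset.sum_congr rfl fun kl hkl => ?_
    rw [← Finset.HasAntidiagonal.mem_antidiagonal.1 hkl, pow_add, ha, hb, Rat.cast_mul]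
    ring
  have h1 := summable_norm_sum_mul_antidiagonal_of_summable_norm hsa hsb
  have h2 := tsum_mul_tsum_eq_tsum_sum_antidiagonal_of_summable_norm hsa hsb
  refine ⟨?_, ?_⟩
  · exact (congrArg (fun u : ℕ → ℂ => Summable fun n => ‖u n‖) key).mpr h1
  · rw [key, ← h2, hg.2, hh.2]

theorem pow (hg : EvalsTo z g v) (n : ℕ) : EvalsTo z (g ^ n) (v ^ n) := by
  induction n with
  | zero => simpa using coe z 1
  | succ n ih => simpa only [pow_succ] using ih.mul hg

theorem aeval (hg : EvalsTo z g v) (P : ℚ[X][X]) :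
    EvalsTo z (Polynomial.aeval g P)
      (∑ i ∈ Finset.range (P.natDegree + 1), Polynomial.aeval z (P.coeff i) * v ^ i) := by
  rw [aeval_eq_sum_range]
  induction Finset.range (P.natDegree + 1) using Finset.induction_on with
  | empty => simpa using coe z 0
  | insert i s hi ih =>
    rw [Finset.sum_insert hi, Finset.sum_insert hi, Algebra.smul_def]
    exact ((coe z (P.coeff i)).mul (hg.pow i)).add ih

theorem eq_zero (h : EvalsTo z 0 v) : v = 0 := by
  rw [← h.2]
  simp

end EvalsTo

open Filter Topology in
/-- The points where an algebraic function blows up are roots of the leading coefficient of its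
equation. -/
theorem aeval_leadingCoeff_eq_zero_of_tendsto_norm_atTop {g : PowerSeries ℚ} {P : ℚ[X][X]}
    (hP : aeval g P = 0) {ι : Type*} {l : Filter ι} [l.NeBot] {z v : ι → ℂ} {z₀ : ℂ}
    (hz : Tendsto z l (𝓝 z₀)) (hv : ∀ᶠ t in l, EvalsTo (z t) g (v t))
    (hv' : Tendsto (fun t => ‖v t‖) l atTop) : aeval z₀ P.leadingCoeff = 0 := by
  -- Dividing the equation by `v ^ deg P` leaves a polynomial in `1 / v`; as `1 / v → 0`, only the
  -- leading coefficient survives.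
  have hinv : Tendsto (fun t => (v t)⁻¹) l (𝓝 0) :=
    tendsto_inv₀_cobounded.comp (tendsto_norm_atTop_iff_cobounded.1 hv')
  have hlim : Tendsto (fun t => ∑ i ∈ Finset.range (P.natDegree + 1),
      aeval (z t) (P.coeff i) * ((v t)⁻¹) ^ (P.natDegree - i)) l
      (𝓝 (∑ i ∈ Finset.range (P.natDegree + 1),
        aeval z₀ (P.coeff i) * 0 ^ (P.natDegree - i))) := by
    refine tendsto_finsetSum _ fun i _ => ?_
    exact (((P.coeff i).continuous_aeval.tendsto z₀).comp hz).mul (hinv.pow _)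
  have hzero : (fun t => ∑ i ∈ Finset.range (P.natDegree + 1),
      aeval (z t) (P.coeff i) * ((v t)⁻¹) ^ (P.natDegree - i)) =ᶠ[l] fun _ => 0 := by
    filter_upwards [hv, hv'.eventually_gt_atTop 0] with t ht ht'
    have hvt : v t ≠ 0 := norm_pos_iff.1 ht'
    have h1 := ht.aeval P
    rw [hP] at h1
    have h2 := congrArg (· * ((v t)⁻¹) ^ P.natDegree) h1.eq_zero
    simp only [zero_mul, Finset.sum_mul] at h2
    rw [← h2]
    refine Finset.sum_congr rfl fun i hi => ?_
    have hle := Nat.lt_succ_iff.1 (Finset.mem_range.1 hi)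
    rw [inv_pow, inv_pow, ← Nat.sub_add_cancel hle, pow_add (v t) _ i, Nat.add_sub_cancel]
    field_simp
  have h3 := tendsto_nhds_unique (hlim.congr' hzero) tendsto_const_nhds
  rw [Finset.sum_range_succ, Nat.sub_self, pow_zero, mul_one, Finset.sum_eq_zero, zero_add] at h3
  · exact h3
  · intro i hi
    have := Finset.mem_range.1 hi
    rw [zero_pow (by omega), mul_zero]

end Evaluation

/-! ### Radial blow-up at roots of unity. -/

section Singularities

open Filter Topology

theorem summable_norm_mul_pow_of_bounded {c : ℕ → ℝ} {B : ℝ} (hc : ∀ n, |c n| ≤ B) {x : ℂ}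
    (hx : ‖x‖ < 1) : Summable fun n => ‖(c n : ℂ) * x ^ n‖ := by
  refine Summable.of_nonneg_of_le (fun _ => norm_nonneg _) (fun n => ?_)
    ((summable_geometric_of_lt_one (norm_nonneg x) hx).mul_left B)
  rw [norm_mul, norm_pow, Complex.norm_real, Real.norm_eq_abs]
  exact mul_le_mul_of_nonneg_right (hc n) (by positivity)

/-- Abel summation of a divergent series with nonnegative bounded terms. -/
theorem tendsto_tsum_mul_pow_atTop {κ : ℕ → ℝ} (h0 : ∀ n, 0 ≤ κ n) {B : ℝ} (hB : ∀ n, κ n ≤ B)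
    (hκ : ¬ Summable κ) : Tendsto (fun ρ : ℝ => ∑' n, κ n * ρ ^ n) (𝓝[<] 1) atTop := by
  rw [tendsto_atTop]
  intro K
  obtain ⟨L, hL⟩ := (((not_summable_iff_tendsto_nat_atTop_of_nonneg h0).1 hκ).eventually_gt_atTop
    K).exists
  have hcont : Tendsto (fun ρ : ℝ => ∑ n ∈ Finset.range L, κ n * ρ ^ n) (𝓝[<] 1)
      (𝓝 (∑ n ∈ Finset.range L, κ n * 1 ^ n)) :=
    ((continuous_finsetSum _ fun n _ => continuous_const.mul (continuous_pow n)).tendsto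
      1).mono_left nhdsWithin_le_nhds
  simp only [one_pow, mul_one] at hcont
  filter_upwards [hcont.eventually (lt_mem_nhds hL), self_mem_nhdsWithin,
    mem_nhdsWithin_of_mem_nhds (lt_mem_nhds (zero_lt_one' ℝ))] with ρ h1 h2 h3
  have hs : Summable fun n => κ n * ρ ^ n :=
    Summable.of_nonneg_of_le (fun n => mul_nonneg (h0 n) (pow_nonneg h3.le n))
      (fun n => mul_le_mul_of_nonneg_right (hB n) (pow_nonneg h3.le n))
      ((summable_geometric_of_lt_one h3.le h2).mul_left B)
  exact h1.le.trans (hs.sum_le_tsum _ fun n _ => mul_nonneg (h0 n) (pow_nonneg h3.le n))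

/-- A periodic sequence has a rational generating series with denominator `1 - x^M`, hence one
bounded near any `ζ` with `ζ^M ≠ 1`. -/
theorem tsum_periodic_mul_pow {π : ℕ → ℝ} {B : ℝ} (hB : ∀ n, |π n| ≤ B) {M : ℕ}
    (hπ : ∀ n, π (n + M) = π n) {x : ℂ} (hx : ‖x‖ < 1) :
    (1 - x ^ M) * ∑' n, (π n : ℂ) * x ^ n = ∑ n ∈ Finset.range M, (π n : ℂ) * x ^ n := by
  have h := (summable_norm_mul_pow_of_bounded hB hx).of_norm.sum_add_tsum_nat_add M
  simp only [hπ, pow_add, ← mul_assoc] at h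
  rw [tsum_mul_right] at h
  linear_combination -h

/-- A bounded sequence which differs from a periodic one by a summable sequence and a divergent
one supported on the multiples of the order of `ζ` has a generating series that blows up at `ζ`. -/
theorem tendsto_norm_tsum_mul_pow_atTop {β π ε κ : ℕ → ℝ} {B : ℝ}
    (hβ : ∀ n, β n = π n + ε n - κ n) (hπB : ∀ n, |π n| ≤ B) (hκB : ∀ n, κ n ≤ B) {M : ℕ}
    (hπ : ∀ n, π (n + M) = π n) (hε : Summable fun n => |ε n|) (h0 : ∀ n, 0 ≤ κ n)
    (hκ : ¬ Summable κ) {ζ : ℂ} (hζ : ‖ζ‖ = 1) (hζM : ζ ^ M ≠ 1)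
    (hsupp : ∀ n, κ n ≠ 0 → ζ ^ n = 1) :
    Tendsto (fun ρ : ℝ => ‖∑' n, (β n : ℂ) * ((ρ : ℂ) * ζ) ^ n‖) (𝓝[<] 1) atTop := by
  have hlim : Tendsto (fun ρ : ℝ => (ρ : ℂ) * ζ) (𝓝[<] 1) (𝓝 ζ) := by
    have : Tendsto (fun ρ : ℝ => (ρ : ℂ) * ζ) (𝓝 1) (𝓝 (((1 : ℝ) : ℂ) * ζ)) :=
      (Complex.continuous_ofReal.mul continuous_const).tendsto 1
    rw [Complex.ofReal_one, one_mul] at this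
    exact this.mono_left nhdsWithin_le_nhds
  have hper : Tendsto (fun ρ : ℝ => ‖(∑ n ∈ Finset.range M, (π n : ℂ) * ((ρ : ℂ) * ζ) ^ n) /
      (1 - ((ρ : ℂ) * ζ) ^ M)‖) (𝓝[<] 1)
      (𝓝 ‖(∑ n ∈ Finset.range M, (π n : ℂ) * ζ ^ n) / (1 - ζ ^ M)‖) :=
    ((tendsto_finsetSum _ fun n _ => (hlim.pow n).const_mul _).div
      (tendsto_const_nhds.sub (hlim.pow M)) (sub_ne_zero.2 hζM.symm)).norm
  have hne : ∀ᶠ ρ : ℝ in 𝓝[<] 1, ((ρ : ℂ) * ζ) ^ M ≠ 1 := (hlim.pow M).eventually_ne hζM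
  set A := ‖(∑ n ∈ Finset.range M, (π n : ℂ) * ζ ^ n) / (1 - ζ ^ M)‖
  have hmain := tendsto_atTop_add_const_right (𝓝[<] (1 : ℝ)) (-(A + 1) - ∑' n, |ε n|)
    (tendsto_tsum_mul_pow_atTop h0 hκB hκ)
  refine tendsto_atTop_mono' _ ?_ hmain
  filter_upwards [hper.eventually_lt_const (lt_add_one A), hne, self_mem_nhdsWithin,
    mem_nhdsWithin_of_mem_nhds (lt_mem_nhds (zero_lt_one' ℝ))] with ρ h1 h2 h3 h4
  have hx : ‖(ρ : ℂ) * ζ‖ = ρ := by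
    rw [norm_mul, hζ, mul_one, Complex.norm_real, Real.norm_eq_abs, abs_of_pos h4]
  have hx1 : ‖(ρ : ℂ) * ζ‖ < 1 := hx.trans_lt h3
  have hsπ := (summable_norm_mul_pow_of_bounded hπB hx1).of_norm
  have hle (n : ℕ) : ‖(ε n : ℂ) * ((ρ : ℂ) * ζ) ^ n‖ ≤ |ε n| := by
    rw [norm_mul, norm_pow, hx, Complex.norm_real, Real.norm_eq_abs]
    exact mul_le_of_le_one_right (abs_nonneg _) (pow_le_one₀ h4.le h3.le)
  have hsε' : Summable fun n => ‖(ε n : ℂ) * ((ρ : ℂ) * ζ) ^ n‖ :=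
    Summable.of_nonneg_of_le (fun _ => norm_nonneg _) hle hε
  have hsε := hsε'.of_norm
  have hsκ := (summable_norm_mul_pow_of_bounded (c := κ)
    (fun n => (abs_of_nonneg (h0 n)).trans_le (hκB n)) hx1).of_norm
  have hsplit : ∑' n, (β n : ℂ) * ((ρ : ℂ) * ζ) ^ n = ∑' n, (π n : ℂ) * ((ρ : ℂ) * ζ) ^ n +
      ∑' n, (ε n : ℂ) * ((ρ : ℂ) * ζ) ^ n - ∑' n, (κ n : ℂ) * ((ρ : ℂ) * ζ) ^ n := by
    rw [← hsπ.tsum_add hsε, ← (hsπ.add hsε).tsum_sub hsκ]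
    refine tsum_congr fun n => ?_
    rw [hβ]
    push_cast
    ring
  -- On the support of `κ` the powers of `ζ` are `1`, so there is no cancellation and Abel summation
  -- applies.
  have hK : ∑' n, (κ n : ℂ) * ((ρ : ℂ) * ζ) ^ n = ((∑' n, κ n * ρ ^ n : ℝ) : ℂ) := by
    rw [Complex.ofReal_tsum]
    refine tsum_congr fun n => ?_
    by_cases hn : κ n = 0
    · simp [hn]
    · rw [mul_pow, hsupp n hn]
      push_cast
      ring
  have hP : ‖∑' n, (π n : ℂ) * ((ρ : ℂ) * ζ) ^ n‖ < A + 1 := by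
    rwa [eq_div_of_mul_eq (sub_ne_zero.2 h2.symm)
      ((mul_comm _ _).trans (tsum_periodic_mul_pow hπB hπ hx1))]
  have hE : ‖∑' n, (ε n : ℂ) * ((ρ : ℂ) * ζ) ^ n‖ ≤ ∑' n, |ε n| :=
    (norm_tsum_le_tsum_norm hsε').trans (hsε'.tsum_le_tsum hle hε)
  rw [hsplit, hK]
  set K := ∑' n, κ n * ρ ^ n
  set U := ∑' n, (π n : ℂ) * ((ρ : ℂ) * ζ) ^ n
  set V := ∑' n, (ε n : ℂ) * ((ρ : ℂ) * ζ) ^ n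
  have h5 : K ≤ ‖(K : ℂ)‖ := by
    rw [Complex.norm_real]
    exact le_abs_self K
  have h6 : ‖(K : ℂ)‖ ≤ ‖U‖ + ‖V‖ + ‖U + V - K‖ := by
    calc ‖(K : ℂ)‖ = ‖(U + V) - (U + V - K)‖ := by congr 1; ring
      _ ≤ ‖U + V‖ + ‖U + V - K‖ := norm_sub_le _ _
      _ ≤ _ := by gcongr; exact norm_add_le _ _
  linarith

end Singularities

/-! ### The rational case, and passage between Laurent and power series. -/

section Rationality

theorem PowerSeries.mk_pow_mul_one_sub {F : Type*} [Field F] (c : F) :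
    (PowerSeries.mk fun n => c ^ n) * (1 - PowerSeries.C c * PowerSeries.X) = 1 := by
  have h := congrArg (PowerSeries.rescale c) (PowerSeries.mk_one_mul_one_sub_eq_one F)
  rw [map_mul, map_sub, map_one, PowerSeries.rescale_X] at h
  rwa [show PowerSeries.rescale c (PowerSeries.mk (1 : ℕ → F)) = PowerSeries.mk fun n => c ^ n from
    PowerSeries.ext fun n => by simp] at h

theorem artinMazurZeta_mul_eq_one {Y : Type*} (f : Y → Y) (D : ℕ)
    (h : ∀ n : ℕ, 1 ≤ n → (Function.ptsOfPeriod f n).ncard = 1 + D ^ n) :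
    artinMazurZeta f * (((1 - X) * (1 - C (D : ℚ) * X) : ℚ[X]) : PowerSeries ℚ) = 1 := by
  have hQ : (((1 - X) * (1 - C (D : ℚ) * X) : ℚ[X]) : PowerSeries ℚ) =
      (1 - PowerSeries.X) * (1 - PowerSeries.C (D : ℚ) * PowerSeries.X) := by
    rw [Polynomial.coe_mul, Polynomial.coe_sub, Polynomial.coe_sub, Polynomial.coe_mul,
      Polynomial.coe_one, Polynomial.coe_C, Polynomial.coe_X]
  rw [hQ]
  have h1 : (PowerSeries.mk fun _ => (1 : ℚ)) * (1 - PowerSeries.X) = 1 :=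
    PowerSeries.mk_one_mul_one_sub_eq_one ℚ
  have h2 := PowerSeries.mk_pow_mul_one_sub (D : ℚ)
  have hG : (PowerSeries.mk fun n => ((Function.ptsOfPeriod f (n + 1)).ncard : ℚ)) =
      (PowerSeries.mk fun _ => (1 : ℚ)) +
        PowerSeries.C (D : ℚ) * PowerSeries.mk fun n => (D : ℚ) ^ n := by
    ext n
    rw [map_add, PowerSeries.coeff_C_mul, PowerSeries.coeff_mk, PowerSeries.coeff_mk,
      PowerSeries.coeff_mk, h (n + 1) n.succ_pos]
    push_cast
    ring
  -- In characteristic zero it suffices to compare derivatives and constant terms; the exponential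
  -- never has to be expanded.
  refine PowerSeries.derivative.ext ?_ ?_
  · rw [PowerSeries.derivative_one, Derivation.leibniz, derivative_artinMazurZeta, hG,
      Derivation.leibniz, map_sub, map_sub, PowerSeries.derivative_one, PowerSeries.derivative_X,
      Derivation.leibniz, PowerSeries.derivative_X, PowerSeries.derivative_C]
    simp only [smul_eq_mul]
    linear_combination artinMazurZeta f * ((1 - PowerSeries.C (D : ℚ) * PowerSeries.X) * h1 +
      PowerSeries.C (D : ℚ) * (1 - PowerSeries.X) * h2)
  · simp [constantCoeff_artinMazurZeta]

theorem isRationalSeries_of_mul_eq_one {F : Type*} [Field F] {z : PowerSeries F} {q : F[X]}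
    (h : z * (q : PowerSeries F) = 1) : IsRationalSeries z := by
  refine ⟨(algebraMap F[X] (RatFunc F) q)⁻¹, ?_⟩
  have h1 := congrArg (HahnSeries.ofPowerSeries ℤ F) h
  rw [map_mul, map_one, RatFunc.coe_coe] at h1
  rw [map_inv₀]
  exact (eq_inv_of_mul_eq_one_left h1).symm

open scoped RatFunc in
theorem isAlgebraic_polynomial_of_laurentSeries {F : Type*} [Field F] {z : PowerSeries F}
    (h : IsAlgebraic (RatFunc F) (z : LaurentSeries F)) : IsAlgebraic F[X] z := by
  obtain ⟨P, hP, hz⟩ := (IsFractionRing.isAlgebraic_iff F[X] (RatFunc F) (LaurentSeries F)).2 h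
  refine ⟨P, hP, HahnSeries.ofPowerSeries_injective (Γ := ℤ) (R := F) ?_⟩
  rw [map_zero, ← hz, aeval_def, aeval_def, hom_eval₂]
  congr 1

end Rationality

/-! ### Infinitely many singularities on the circle of radius `1 / D`. -/

section Transcendence

variable {p : ℕ} [Fact p.Prime]

theorem padicValNat_gcd_le {j : ℕ} (hj : j ≠ 0) (E : ℕ) :
    padicValNat p (j.gcd (p ^ E)) ≤ padicValNat p j := by
  rw [← padicValNat_dvd_iff_le hj]
  exact pow_padicValNat_dvd.trans (Nat.gcd_dvd_left _ _)

/-- The valuation of `gcd(j, p^E)` is that of `j` capped at `E`: a function of `j` of period `p^E`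
that is exact unless `p^(E+1)` divides `j`. -/
theorem padicValNat_gcd_eq {j E : ℕ} (hj : j ≠ 0) (hE : ¬ p ^ (E + 1) ∣ j) :
    padicValNat p (j.gcd (p ^ E)) = padicValNat p j := by
  refine le_antisymm (padicValNat_gcd_le hj E) ?_
  have hle : padicValNat p j ≤ E := by
    by_contra hlt
    exact hE ((padicValNat_dvd_iff_le hj).2 (by omega))
  rw [← padicValNat_dvd_iff_le (Nat.gcd_pos_of_pos_left _ (Nat.pos_of_ne_zero hj)).ne']
  exact Nat.dvd_gcd pow_padicValNat_dvd (pow_dvd_pow p hle)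

open Filter Topology in
/-- If `b n = 1 + D ^ n` outside the multiples of `m`, with a correction at `m * j` depending on
the `p`-adic valuation of `j`, the series `∑ b n t ^ n` blows up at `ζ / D` for every primitive root
of unity `ζ` of order `m * p ^ (E + 1)`. -/
theorem exists_evalsTo_tendsto_norm_atTop {b : ℕ → ℕ} {D d m : ℕ} (hD : 2 ≤ D) (hd : 0 < d)
    (hm : m ≠ 0) {S : ℝ} (hS : 1 < S) (hb : ∀ n, ¬ m ∣ n → b n = 1 + D ^ n)
    (hbm : ∀ j, j ≠ 0 → (b (m * j) : ℝ) = 1 + (D : ℝ) ^ (m * j) -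
      (d : ℝ)⁻¹ * (D : ℝ) ^ (m * j) * (1 - (S ^ p ^ padicValNat p j)⁻¹))
    (E : ℕ) {ζ : ℂ} (hζ : IsPrimitiveRoot ζ (m * p ^ (E + 1))) :
    ∃ v : ℝ → ℂ, (∀ᶠ ρ : ℝ in 𝓝[<] 1, EvalsTo ((ρ : ℂ) * ζ / D)
      (PowerSeries.mk fun n => if n = 0 then 0 else (b n : ℚ)) (v ρ)) ∧
      Tendsto (fun ρ => ‖v ρ‖) (𝓝[<] 1) atTop := by
  have hp := (Fact.out : p.Prime)
  have hD0 : (0 : ℝ) < D := by exact_mod_cast (by omega : 0 < D)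
  have hd0 : (0 : ℝ) < (d : ℝ)⁻¹ := inv_pos.2 (by exact_mod_cast hd)
  have hd1 : (d : ℝ)⁻¹ ≤ 1 := inv_le_one_of_one_le₀ (by exact_mod_cast hd)
  set u : ℕ → ℝ := fun e => (S ^ p ^ e)⁻¹ with hu
  have hu0 (e : ℕ) : 0 < u e := inv_pos.2 (pow_pos (zero_lt_one.trans hS) _)
  have hu1 (e : ℕ) : u e ≤ 1 := inv_le_one_of_one_le₀ (one_le_pow₀ hS.le)
  have hanti : StrictAnti u := fun e e' h => inv_strictAnti₀ (pow_pos (zero_lt_one.trans hS) _)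
    (pow_lt_pow_right₀ hS (Nat.pow_lt_pow_right hp.one_lt h))
  -- `b n / D^n` with the valuation capped at `E` is `π`, of period `m p^E`. The error `κ` of
  -- capping lives on multiples of `m p^(E+1)`, and `ε` is the `D^(-n)` from the point at infinity;
  -- its value at `0` makes `β 0 = 0`.
  set π : ℕ → ℝ := fun n => 1 - if m ∣ n then
    (d : ℝ)⁻¹ * (1 - u (padicValNat p ((n / m).gcd (p ^ E)))) else 0 with hπdef
  set κ : ℕ → ℝ := fun n => if n ≠ 0 ∧ m ∣ n then
    (d : ℝ)⁻¹ * (u (padicValNat p ((n / m).gcd (p ^ E))) - u (padicValNat p (n / m))) else 0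
    with hκdef
  set ε : ℕ → ℝ := fun n => if n = 0 then -π 0 else ((D : ℝ)⁻¹) ^ n with hεdef
  set β : ℕ → ℝ := fun n => if n = 0 then 0 else (b n : ℝ) / (D : ℝ) ^ n with hβdef
  have hquot {n : ℕ} (h0 : n ≠ 0) (h : m ∣ n) : n / m ≠ 0 :=
    (Nat.div_pos (Nat.le_of_dvd (Nat.pos_of_ne_zero h0) h) (Nat.pos_of_ne_zero hm)).ne'
  have hβ (n : ℕ) : β n = π n + ε n - κ n := by
    by_cases h0 : n = 0
    · simp [hβdef, hεdef, hκdef, h0]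
    have hDn : (D : ℝ) ^ n ≠ 0 := pow_ne_zero _ hD0.ne'
    by_cases hmn : m ∣ n
    · obtain ⟨j, rfl⟩ := hmn
      have hj : j ≠ 0 := right_ne_zero_of_mul h0
      simp only [hβdef, hεdef, hκdef, hπdef, if_neg h0, if_pos (dvd_mul_right m j), ne_eq,
        h0, not_false_eq_true, true_and, Nat.mul_div_cancel_left j (Nat.pos_of_ne_zero hm),
        hbm j hj, inv_pow]
      change _ = _ - (d : ℝ)⁻¹ * (_ - (S ^ p ^ padicValNat p j)⁻¹)
      generalize (S ^ p ^ padicValNat p j)⁻¹ = y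
      field_simp
      ring
    · simp only [hβdef, hεdef, hκdef, hπdef, if_neg h0, hmn, and_false, if_false,
        hb n hmn, inv_pow]
      push_cast
      field_simp
      ring
  have hπB (n : ℕ) : |π n| ≤ 2 := by
    simp only [hπdef]
    split_ifs
    · have h1 := hu0 (padicValNat p ((n / m).gcd (p ^ E)))
      have h2 := hu1 (padicValNat p ((n / m).gcd (p ^ E)))
      rw [abs_le]
      constructor <;> nlinarith
    · norm_num
  have hκ0 (n : ℕ) : 0 ≤ κ n := by
    simp only [hκdef]
    split_ifs with h
    · exact mul_nonneg hd0.le (sub_nonneg.2 (hanti.antitone (padicValNat_gcd_le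
        (hquot h.1 h.2) E)))
    · exact le_rfl
  have hκB (n : ℕ) : κ n ≤ 2 := by
    simp only [hκdef]
    split_ifs with h
    · have h1 := hu0 (padicValNat p (n / m))
      have h2 := hu1 (padicValNat p ((n / m).gcd (p ^ E)))
      nlinarith
    · norm_num
  have hεB (n : ℕ) : |ε n| ≤ 2 := by
    simp only [hεdef]
    split_ifs
    · rw [abs_neg]
      exact hπB 0
    · rw [abs_of_nonneg (by positivity)]
      exact (pow_le_one₀ (by positivity) (inv_le_one_of_one_le₀
        (by exact_mod_cast (by omega : 1 ≤ D)))).trans one_le_two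
  have hε : Summable fun n => |ε n| := by
    have hgeo : Summable fun n : ℕ => ((D : ℝ)⁻¹) ^ n :=
      summable_geometric_of_lt_one (by positivity)
        (inv_lt_one_of_one_lt₀ (by exact_mod_cast (by omega : 1 < D)))
    rw [← summable_nat_add_iff 1]
    refine ((summable_nat_add_iff 1).2 hgeo).congr fun n => ?_
    simp only [hεdef, if_neg n.succ_ne_zero]
    exact (abs_of_nonneg (by positivity)).symm
  have hπ (n : ℕ) : π (n + m * p ^ E) = π n := by
    simp only [hπdef, Nat.add_mul_div_left _ _ (Nat.pos_of_ne_zero hm), Nat.gcd_add_self_left,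
      (Nat.dvd_add_left (dvd_mul_right m (p ^ E)))]
  have hδ : 0 < (d : ℝ)⁻¹ * (u E - u (E + 1)) :=
    mul_pos hd0 (sub_pos.2 (hanti E.lt_succ_self))
  -- On positive multiples of `m p^(E+1)`, `κ` is at least the fixed positive number of `hδ`.
  have hκ : ¬ Summable κ := by
    intro hsum
    have hinj : Function.Injective fun k : ℕ => m * (p ^ (E + 1) * (k + 1)) := by
      intro k l hkl
      have h1 := Nat.eq_of_mul_eq_mul_left (Nat.pos_of_ne_zero hm) hkl
      have h2 := Nat.eq_of_mul_eq_mul_left (pow_pos hp.pos _) h1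
      omega
    have h1 := (hsum.comp_injective hinj).tendsto_atTop_zero
    obtain ⟨k, hk⟩ := (h1.eventually (gt_mem_nhds hδ)).exists
    have hj : p ^ (E + 1) * (k + 1) ≠ 0 := mul_ne_zero (pow_ne_zero _ hp.ne_zero) k.succ_ne_zero
    have hgcd : (p ^ (E + 1) * (k + 1)).gcd (p ^ E) = p ^ E :=
      Nat.gcd_eq_right ((pow_dvd_pow p E.le_succ).trans (dvd_mul_right _ _))
    have hv : E + 1 ≤ padicValNat p (p ^ (E + 1) * (k + 1)) :=
      (padicValNat_dvd_iff_le hj).1 (dvd_mul_right _ _)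
    refine absurd hk (not_lt.2 ?_)
    simp only [hκdef, Function.comp_apply]
    rw [if_pos ⟨mul_ne_zero hm hj, dvd_mul_right _ _⟩,
      Nat.mul_div_cancel_left _ (Nat.pos_of_ne_zero hm), hgcd, padicValNat.prime_pow]
    exact mul_le_mul_of_nonneg_left (sub_le_sub_left (hanti.antitone hv) _) hd0.le
  have hN : m * p ^ (E + 1) ≠ 0 := mul_ne_zero hm (pow_ne_zero _ hp.ne_zero)
  have hζM : ζ ^ (m * p ^ E) ≠ 1 := by
    refine hζ.pow_ne_one_of_pos_of_lt (mul_ne_zero hm (pow_ne_zero _ hp.ne_zero)) ?_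
    exact Nat.mul_lt_mul_of_pos_left (Nat.pow_lt_pow_right hp.one_lt E.lt_succ_self)
      (Nat.pos_of_ne_zero hm)
  have hsupp (n : ℕ) (hn : κ n ≠ 0) : ζ ^ n = 1 := by
    simp only [hκdef] at hn
    split_ifs at hn with h
    · obtain ⟨j, rfl⟩ := h.2
      rw [Nat.mul_div_cancel_left _ (Nat.pos_of_ne_zero hm)] at hn
      rw [hζ.pow_eq_one_iff_dvd]
      refine mul_dvd_mul_left m ?_
      by_contra hdvd
      exact hn (by rw [padicValNat_gcd_eq (right_ne_zero_of_mul h.1) hdvd, sub_self, mul_zero])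
    · exact absurd rfl hn
  have hβB (n : ℕ) : |β n| ≤ 6 := by
    rw [hβ, abs_le]
    have h1 := abs_le.1 (hπB n)
    have h2 := abs_le.1 (hεB n)
    have h3 := hκ0 n
    have h4 := hκB n
    constructor <;> linarith
  have hζ1 : ‖ζ‖ = 1 := hζ.norm'_eq_one hN
  refine ⟨fun ρ => ∑' n, (β n : ℂ) * ((ρ : ℂ) * ζ) ^ n, ?_,
    tendsto_norm_tsum_mul_pow_atTop hβ hπB hκB hπ hε hκ0 hκ hζ1 hζM hsupp⟩
  filter_upwards [self_mem_nhdsWithin,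
    mem_nhdsWithin_of_mem_nhds (lt_mem_nhds (zero_lt_one' ℝ))] with ρ h1 h2
  have hx : ‖(ρ : ℂ) * ζ‖ < 1 := by
    rw [norm_mul, hζ1, mul_one, Complex.norm_real, Real.norm_eq_abs, abs_of_pos h2]
    exact h1
  have hDC : (D : ℂ) ≠ 0 := by exact_mod_cast (by omega : D ≠ 0)
  have hterm : (fun n => ((PowerSeries.coeff n (PowerSeries.mk fun n =>
      if n = 0 then 0 else (b n : ℚ)) : ℚ) : ℂ) * ((ρ : ℂ) * ζ / D) ^ n) =
      fun n => (β n : ℂ) * ((ρ : ℂ) * ζ) ^ n := by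
    funext n
    rw [PowerSeries.coeff_mk]
    simp only [hβdef]
    split_ifs with h0
    · simp
    · push_cast
      rw [div_pow]
      ring
  exact ⟨(congrArg (fun w : ℕ → ℂ => Summable fun n => ‖w n‖) hterm).mpr
    (summable_norm_mul_pow_of_bounded hβB hx), congrArg tsum hterm⟩

open Filter Topology in
theorem not_isAlgebraic_mk_of_padicValNat {b : ℕ → ℕ} {D d m : ℕ} (hD : 2 ≤ D) (hd : 0 < d)
    (hm : m ≠ 0) {S : ℝ} (hS : 1 < S) (hb : ∀ n, ¬ m ∣ n → b n = 1 + D ^ n)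
    (hbm : ∀ j, j ≠ 0 → (b (m * j) : ℝ) = 1 + (D : ℝ) ^ (m * j) -
      (d : ℝ)⁻¹ * (D : ℝ) ^ (m * j) * (1 - (S ^ p ^ padicValNat p j)⁻¹)) :
    ¬ IsAlgebraic ℚ[X] (PowerSeries.mk fun n => if n = 0 then 0 else (b n : ℚ)) := by
  rintro ⟨P, hP, hz⟩
  have hp := (Fact.out : p.Prime)
  have hN (E : ℕ) : m * p ^ (E + 1) ≠ 0 := mul_ne_zero hm (pow_ne_zero _ hp.ne_zero)
  have hDC : (D : ℂ) ≠ 0 := by exact_mod_cast (by omega : D ≠ 0)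
  let ζ (E : ℕ) : ℂ := Complex.exp (2 * Real.pi * Complex.I / (m * p ^ (E + 1) : ℕ))
  have hζ (E : ℕ) : IsPrimitiveRoot (ζ E) (m * p ^ (E + 1)) := Complex.isPrimitiveRoot_exp _ (hN E)
  have hroot (E : ℕ) : aeval (ζ E / D) P.leadingCoeff = 0 := by
    obtain ⟨v, hv, hv'⟩ := exists_evalsTo_tendsto_norm_atTop hD hd hm hS hb hbm E (hζ E)
    refine aeval_leadingCoeff_eq_zero_of_tendsto_norm_atTop hz ?_ hv hv'
    have : Tendsto (fun ρ : ℝ => (ρ : ℂ) * ζ E / D) (𝓝 1) (𝓝 (((1 : ℝ) : ℂ) * ζ E / D)) :=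
      ((Complex.continuous_ofReal.mul continuous_const).div_const _).tendsto 1
    rw [Complex.ofReal_one, one_mul] at this
    exact this.mono_left nhdsWithin_le_nhds
  -- The orders `m p^(E+1)` are distinct, so the leading coefficient has infinitely many roots.
  have hinj : Function.Injective fun E => ζ E / D := by
    intro E E' h
    have h1 : ζ E = ζ E' := (div_left_inj' hDC).1 h
    have h2 : m * p ^ (E + 1) = m * p ^ (E' + 1) := by
      rw [(hζ E).eq_orderOf, (hζ E').eq_orderOf, h1]
    have h3 := Nat.pow_right_injective hp.two_le
      (Nat.eq_of_mul_eq_mul_left (Nat.pos_of_ne_zero hm) h2)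
    omega
  have hzero : P.leadingCoeff.map (algebraMap ℚ ℂ) = 0 := by
    refine eq_zero_of_infinite_isRoot _ (Set.infinite_of_injective_forall_mem hinj fun E => ?_)
    show eval _ _ = 0
    rw [eval_map_algebraMap]
    exact hroot E
  exact leadingCoeff_ne_zero.2 hP
    ((Polynomial.map_eq_zero_iff (algebraMap ℚ ℂ).injective).1 hzero)

end Transcendence

/-! ### The main theorem. -/

theorem theorem1p3 {p : ℕ} [Fact p.Prime] {k : Type*} [Field k] [IsAlgClosed k] [CharP k p]
    [Algebra (ZMod p) k] (f : k[X])
    (hf : IsAffineAdditivePoly f ∨ IsSubadditivePoly p f)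
    -- `f` is separable as a self-map of the projective line
    (hsep : derivative f ≠ 0) :
    (∀ n : ℕ, 1 ≤ n → (Function.ptsOfPeriod (polyMapP1 f) n).Finite) ∧
    (IsAlgebraic (ZMod p) ((derivative f).eval 0) →
      IsTranscendentalSeries (artinMazurZeta (polyMapP1 f))) ∧
    (Transcendental (ZMod p) ((derivative f).eval 0) →
      (∀ n : ℕ, 1 ≤ n →
        (Function.ptsOfPeriod (polyMapP1 f) n).ncard = 1 + f.natDegree ^ n) ∧
      IsRationalSeries (artinMazurZeta (polyMapP1 f))) := by
  obtain ⟨d, σ, e, h⟩ : ∃ d σ e, IsQuotientOfAdditive f d σ e := by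
    rcases hf with hf | hf
    · exact ⟨1, isQuotientOfAdditive_of_affine hf hsep⟩
    · obtain ⟨d, σ, h⟩ := isQuotientOfAdditive_of_subadditive p hf hsep
      exact ⟨d, σ, _, h⟩
  have hd : 0 < d := Nat.pos_of_ne_zero (by rintro rfl; exact h.cast_ne_zero Nat.cast_zero)
  have hD : 2 ≤ f.natDegree := h.natDegree_eq ▸ h.two_le
  refine ⟨fun n hn => h.finite_ptsOfPeriod (by omega), fun halg hzeta => ?_, fun htr => ?_⟩
  · have h0 : (derivative f).eval 0 ≠ 0 := by
      rw [h.eval_derivative_eq]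
      exact pow_ne_zero _ h.eval_derivative_ne_zero
    obtain ⟨n, hn, hn1⟩ := exists_pow_eq_one_of_isAlgebraic halg h0
    -- Taking `m` to be the exact order makes `f'(0)^n ≠ 1` for every `n` not divisible by `m`, so
    -- the full count holds there.
    have hm : orderOf ((derivative f).eval 0) ≠ 0 :=
      (orderOf_pos_iff.2 (isOfFinOrder_iff_pow_eq_one.2 ⟨n, Nat.pos_of_ne_zero hn, hn1⟩)).ne'
    obtain ⟨S, hS, hcard⟩ := h.exists_ncard_ptsOfPeriod p hm (pow_orderOf_eq_one _)
    refine not_isAlgebraic_mk_of_padicValNat hD hd hm hS (fun n hn => ?_) hcard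
      (isAlgebraic_of_isAlgebraic_artinMazurZeta _ (isAlgebraic_polynomial_of_laurentSeries hzeta))
    refine h.ncard_ptsOfPeriod_of_ne ?_ fun h1 => hn (orderOf_dvd_of_pow_eq_one h1)
    rintro rfl
    exact hn (dvd_zero _)
  · have hcount (n : ℕ) (hn : 1 ≤ n) :
        (Function.ptsOfPeriod (polyMapP1 f) n).ncard = 1 + f.natDegree ^ n :=
      h.ncard_ptsOfPeriod_of_ne (by omega) (pow_ne_one_of_transcendental htr (by omega))
    exact ⟨hcount, isRationalSeries_of_mul_eq_one (artinMazurZeta_mul_eq_one _ _ hcount)⟩
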